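/- **Setting.** All logarithms are to base $2$, and $\log^* q$ is the least number of times that $\log$ has to be applied to $q$ until the result is at most $1$. The neighborhood independence of a graph is the largest number of pairwise non-adjacent neighbors of a single node. In a *list coloring instance with slack at least $S$ and color space of size at most $C$* on a finite simple graph $G=(V,E)$, every node $v$ has a list $L_v\subseteq\{0,\dots,C-1\}$ and a defect function $d_v:L_v\to\mathbb{N}_0$ such that $\sum_{x\in L_v}(d_v(x)+1)>S\cdot\deg(v)$. A *list defective coloring* assigns to each node $v$ a color $x_v\in L_v$ such that at most $d_v(x_v)$ neighbors $u$ of $v$ have $x_u=x_v$. A *list arbdefective coloring* assigns to each node $v$ a color $x_v\in L_v$ and orients every monochromatic edge such that each node $v$ has at most $d_v(x_v)$ out-neighbors of color $x_v$. Consider the deterministic $\mathsf{LOCAL}$ model (synchronous rounds, unbounded messages over the edges of $G$, unique node identifiers from $\{0,\dots,N-1\}$) on graphs with at most $n$ nodes, maximum degree at most $\Delta$ and neighborhood independence at most $\theta$ that are given together with a proper $q$-coloring; initially each node knows its identifier, its color in the $q$-coloring, its degree, its list and its defect function, and the algorithm may depend on $n,N,\Delta,\theta,q,S,C$. Let $T_D(S,C)$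 and $T_A(S,C)$ be the smallest number of rounds (in $\mathbb{N}\cup\{\infty\}$) in which some such algorithm solves, on all these graphs, all list defective, respectively list arbdefective, coloring instances with slack at least $S$ and color space of size at most $C$; in the arbdefective case both endpoints of each monochromatic edge have to output its orientation. **Theorem.** There is an absolute constant $c>0$ such that for all integers $n,N,\Delta,\theta,q,C\ge 0$ and every real $S\geq 1$, $$T_D(16\cdot\theta\cdot S,\,C)\;\le\; c\cdot\log^3\Delta\cdot T_A(S,C)\;+\;c\cdot\log^* q,$$ where both complexities refer to the same parameters $n,N,\Delta,\theta,q$, and with the conventions $\log 0=0$ and $0\cdot\infty=0$. That is, $T_D(16\theta S,C)\le O(\log^3\Delta)\cdot T_A(S,C)+O(\log^* q)$. -/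

import Mathlib

open scoped ENNReal

noncomputable section

/-- The iterated logarithm `log* q` (base two): the least number of times that the binary
logarithm has to be applied to `q` until the result is at most `1`. -/
def logStar (q : ℕ) : ℕ := sInf {k : ℕ | (Real.logb 2)^[k] (q : ℝ) ≤ 1}

/-- The neighborhood independence of a finite graph: the largest size of a set of pairwise
non-adjacent neighbors of a single node. -/
def SimpleGraph.nbhdIndependence {V : Type} [Fintype V] (G : SimpleGraph V) : ℕ :=
  Finset.univ.sup fun v : V => (G.induce (G.neighborSet v)).indepNum

/-! ### The deterministic `LOCAL` model -/

/-- A deterministic algorithm in the `LOCAL` model. All nodes run the same algorithm. In every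
round each node sends a message of unbounded size over each incident edge (the message may depend
on the identifier of the receiving neighbor) and then updates its state from its old state and the
messages that it has received, each of them tagged with the identifier of its sender.
Local computation is unrestricted. -/
structure LocalAlgorithm (Input Output : Type) where
  State : Type
  Msg : Type
  init : Input → State
  send : State → ℕ → Msg
  receive : State → Set (ℕ × Msg) → State
  output : State → Output

/-- The state of every node after `t` synchronous rounds on the graph `G`, where `ident` are the
node identifiers and `inp` is the information that each node has at the beginning. -/
def LocalAlgorithm.stateAfter {Input Output V : Type} (A : LocalAlgorithm Input Output)
    (G : SimpleGraph V) (ident : V → ℕ) (inp : V → Input) : ℕ → V → A.State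
  | 0 => fun v => A.init (inp v)
  | t + 1 => fun v =>
      A.receive (A.stateAfter G ident inp t v)
        {p | ∃ u, G.Adj v u ∧
          p = (ident u, A.send (A.stateAfter G ident inp t u) (ident v))}

/-- The output of every node after `T` rounds. -/
def LocalAlgorithm.run {Input Output V : Type} (A : LocalAlgorithm Input Output)
    (G : SimpleGraph V) (ident : V → ℕ) (inp : V → Input) (T : ℕ) (v : V) : Output :=
  A.output (A.stateAfter G ident inp T v)

/-! ### Networks and list (arb)defective coloring instances -/

/-- The parameters that are known to all nodes: upper bounds on the number of nodes `n`, on the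
maximum degree `Δ` and on the neighborhood independence `θ`, the number `N` of possible
identifiers, and the number `q` of colors of the initial proper coloring. -/
structure NetworkParams where
  n : ℕ
  N : ℕ
  Δ : ℕ
  θ : ℕ
  q : ℕ

open Classical in
/-- A network: a graph on the node set `V` with unique node identifiers from `{0, …, N - 1}` and
an initial proper `q`-coloring, which obeys the bounds given by the parameters. -/
structure Network (p : NetworkParams) (V : Type) [Fintype V] where
  graph : SimpleGraph V
  card_le : Fintype.card V ≤ p.n
  maxDegree_le : graph.maxDegree ≤ p.Δ
  nbhdIndependence_le : graph.nbhdIndependence ≤ p.θ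
  ident : V → ℕ
  ident_injective : Function.Injective ident
  ident_lt : ∀ v, ident v < p.N
  initColor : graph.Coloring (Fin p.q)

open Classical in
/-- The degree of a node in a network. -/
def Network.deg {p : NetworkParams} {V : Type} [Fintype V] (W : Network p V) (v : V) : ℕ :=
  W.graph.degree v

/-- An instance of list defective (or list arbdefective) coloring with slack at least `S` and
color space `{0, …, C - 1}`: lists `L v` and defects `d v x` for `x ∈ L v` (the values
`d v x` for `x ∉ L v` play no role). -/
structure ListInstance {p : NetworkParams} {V : Type} [Fintype V] (W : Network p V)
    (S : ℝ) (C : ℕ) where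
  L : V → Finset ℕ
  d : V → ℕ → ℕ
  list_subset : ∀ v, L v ⊆ Finset.range C
  slack : ∀ v, S * (W.deg v : ℝ) < ∑ x ∈ L v, ((d v x : ℝ) + 1)

/-- What a node knows at the beginning: its identifier, its initial color, its degree, its list
and its defects. -/
structure NodeInput where
  ident : ℕ
  initColor : ℕ
  degree : ℕ
  list : Finset ℕ
  defect : ℕ → ℕ

/-- The initial knowledge of the nodes in a list (arb)defective coloring instance. -/
def ListInstance.input {p : NetworkParams} {V : Type} [Fintype V] {W : Network p V}
    {S : ℝ} {C : ℕ} (I : ListInstance W S C) (v : V) : NodeInput where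
  ident := W.ident v
  initColor := (W.initColor v : ℕ)
  degree := W.deg v
  list := I.L v
  defect := I.d v

/-- `x` solves the list defective coloring instance: every node gets a color from its list, and
at most `d v (x v)` neighbors of `v` have the same color as `v`. -/
def ListInstance.IsDefectiveColoring {p : NetworkParams} {V : Type} [Fintype V]
    {W : Network p V} {S : ℝ} {C : ℕ} (I : ListInstance W S C) (x : V → ℕ) : Prop :=
  ∀ v, x v ∈ I.L v ∧ {u | W.graph.Adj v u ∧ x u = x v}.ncard ≤ I.d v (x v)

/-- The output of a node in list arbdefective coloring: a color, and the set of the identifiers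
of those neighbors towards which the node orients its monochromatic edges. -/
structure ArbOutput where
  color : ℕ
  out : Set ℕ

/-- `y` solves the list arbdefective coloring instance: every node gets a color from its list,
every monochromatic edge is oriented in exactly one direction (and its two endpoints agree on
it), and every node `v` has at most `d v x` out-neighbors of its own color `x`. -/
def ListInstance.IsArbdefectiveColoring {p : NetworkParams} {V : Type} [Fintype V]
    {W : Network p V} {S : ℝ} {C : ℕ} (I : ListInstance W S C) (y : V → ArbOutput) : Prop :=
  (∀ v, (y v).color ∈ I.L v) ∧
  (∀ u v, W.graph.Adj u v → (y u).color = (y v).color →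
    Xor (W.ident v ∈ (y u).out) (W.ident u ∈ (y v).out)) ∧
  (∀ v, {u | W.graph.Adj v u ∧ (y u).color = (y v).color ∧ W.ident u ∈ (y v).out}.ncard
    ≤ I.d v (y v).color)

/-! ### Optimal round complexities -/

/-- `A` solves in `T` rounds all list defective coloring instances with slack at least `S` and a
color space of size at most `C`, on all networks with parameters `p`. -/
def SolvesDefective (p : NetworkParams) (S : ℝ) (C : ℕ) (T : ℕ)
    (A : LocalAlgorithm NodeInput ℕ) : Prop :=
  ∀ (V : Type) [Fintype V] (W : Network p V) (I : ListInstance W S C),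
    I.IsDefectiveColoring (A.run W.graph W.ident I.input T)

/-- `A` solves in `T` rounds all list arbdefective coloring instances with slack at least `S` and
a color space of size at most `C`, on all networks with parameters `p`. -/
def SolvesArbdefective (p : NetworkParams) (S : ℝ) (C : ℕ) (T : ℕ)
    (A : LocalAlgorithm NodeInput ArbOutput) : Prop :=
  ∀ (V : Type) [Fintype V] (W : Network p V) (I : ListInstance W S C),
    I.IsArbdefectiveColoring (A.run W.graph W.ident I.input T)

/-- `T_D(S, C)`: the optimal deterministic round complexity of list defective coloring. -/
def TD (p : NetworkParams) (S : ℝ) (C : ℕ) : ℕ∞ :=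
  ⨅ (T : ℕ) (_ : ∃ A, SolvesDefective p S C T A), (T : ℕ∞)

/-- `T_A(S, C)`: the optimal deterministic round complexity of list arbdefective coloring. -/
def TA (p : NetworkParams) (S : ℝ) (C : ℕ) : ℕ∞ :=
  ⨅ (T : ℕ) (_ : ∃ A, SolvesArbdefective p S C T A), (T : ℕ∞)

end

/-!
List defective coloring reduces to list arbdefective coloring on graphs of neighborhood
independence `θ`, because of the following fact (`SimpleGraph.ncard_sameColor_le`). Suppose that
the monochromatic edges are oriented such that a node `v` has at most `D v` out-neighbors of its
own color, and such that `D` does not decrease along the orientation. The in-neighbors of `v` of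
its own color then induce a graph with out-degrees at most `D v - 1`, which has a large independent
set. As this set consists of neighbors of `v`, there are at most `3 * θ * D v` neighbors of `v` with
its color.

To get a monotone orientation, the defects are rounded to `O(log Δ)` levels, where level `i` allows
out-degree `2 ^ i - 1`, and the levels are treated in decreasing order; edges between nodes that are
colored at different times are oriented towards the node that has been colored first. To decide
which nodes get a color of level `i`, a base coloring with `O(log² Δ)` colors is used in which only
a `1 / (⌊log Δ⌋ + 1)` fraction of the neighbors of each node `v` shares its base color
(`exists_defective_base_coloring`). In the phase of level `i` and base color `k`, those uncolored
nodes of base color `k` run the arbdefective algorithm whose weight left on level `i` exceeds `S`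
times the number of neighbors of the same base color (`exists_phaseStep`). A node that remained
uncolored in the end would have at most `S * deg v` weight left on all levels together, while its
neighbors use up at most `deg v`, and this contradicts the slack (`PhaseInvariant.ne_none`).

The base coloring results from iterated color reduction with polynomials over `ZMod f`: it needs
`log* q` rounds to get to `Δ ^ O(1)` proper colors (`ProperlyColorable.iterate`) and two more
rounds that admit defects.

There are `O(log³ Δ)` phases with `T_A + 2` rounds each. The additive constants are absorbed since
`T_A ≥ 1` unless the problem is trivial (`not_solvesArbdefective_zero`). The case `Δ = 1`, where
`log Δ = 0`, is solved directly in one round (`TD_le_one`).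

Compositions of algorithms are expressed through views: a labeling is `LocallyComputable` in `T`
rounds if it is a function of the `T`-round view, and the full-information algorithm turns such a
function into an algorithm.
-/

noncomputable section

variable {p : NetworkParams} {S S' : ℝ} {C : ℕ} {α β : Type}

/-! ### Views and local computability -/

/-- The information that a node can gather within `t` rounds: its `(t - 1)`-round view together
with the `(t - 1)`-round views of its neighbors, tagged with their identifiers. -/
def LocalView (Input : Type) : ℕ → Type
  | 0 => Input
  | t + 1 => LocalView Input t × Set (ℕ × LocalView Input t)

/-- The `t`-round view of a node in a concrete graph. -/
def localView {Input V : Type} (G : SimpleGraph V) (ident : V → ℕ) (inp : V → Input) :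
    (t : ℕ) → V → LocalView Input t
  | 0 => inp
  | t + 1 => fun v => (localView G ident inp t v,
      {p | ∃ u, G.Adj v u ∧ p = (ident u, localView G ident inp t u)})

/-- The full-information algorithm: gather the `T`-round view and apply `g` to it. The state
carries the number of elapsed rounds, because the type of the view depends on it. -/
def fullInformation {Input Output : Type} [Inhabited Output] (T : ℕ)
    (g : LocalView Input T → Output) : LocalAlgorithm Input Output where
  State := Σ t, LocalView Input t
  Msg := Σ t, LocalView Input t
  init x := ⟨0, x⟩
  send s _ := s
  receive s M := ⟨s.1 + 1, (s.2, {p | (p.1, (⟨s.1, p.2⟩ : Σ t, LocalView Input t)) ∈ M})⟩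
  output s := if h : s.1 = T then g (h ▸ s.2) else default

theorem fullInformation_stateAfter {Input Output V : Type} [Inhabited Output] (T : ℕ)
    (g : LocalView Input T → Output) (G : SimpleGraph V) (ident : V → ℕ) (inp : V → Input)
    (t : ℕ) (v : V) :
    (fullInformation T g).stateAfter G ident inp t v = ⟨t, localView G ident inp t v⟩ := by
  induction t generalizing v with
  | zero => rfl
  | succ t ih =>
    rw [LocalAlgorithm.stateAfter]
    simp only [ih]
    refine congrArg (fun s => (⟨t + 1, (localView G ident inp t v, s)⟩ :
      Σ t, LocalView Input t)) (Set.ext fun p => ?_)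
    simp only [Set.mem_ofPred_eq, Prod.ext_iff]
    exact exists_congr fun u => and_congr_right fun _ => and_congr_right fun _ =>
      ⟨fun h => eq_of_heq (Sigma.mk.inj h).2, fun h => congrArg (Sigma.mk t) h⟩

theorem fullInformation_run {Input Output V : Type} [Inhabited Output] (T : ℕ)
    (g : LocalView Input T → Output) (G : SimpleGraph V) (ident : V → ℕ) (inp : V → Input)
    (v : V) :
    (fullInformation T g).run G ident inp T v = g (localView G ident inp T v) := by
  rw [LocalAlgorithm.run, fullInformation_stateAfter]
  simp [fullInformation]

/-- A network together with a list coloring instance on it. -/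
structure BundledInstance (p : NetworkParams) (S : ℝ) (C : ℕ) where
  V : Type
  [fintype : Fintype V]
  W : Network p V
  I : ListInstance W S C

attribute [instance] BundledInstance.fintype

/-- A family of node labelings, one for each instance, is locally computable in `T` rounds if the
label of a node is a function of its `T`-round view. -/
def LocallyComputable (T : ℕ) (f : ∀ X : BundledInstance p S C, X.V → α) : Prop :=
  ∃ g : LocalView NodeInput T → α, ∀ X v,
    f X v = g (localView X.W.graph X.W.ident X.I.input T v)

namespace LocallyComputable

theorem of_input (h : NodeInput → α) :
    LocallyComputable 0 (fun (X : BundledInstance p S C) v => h (X.I.input v)) :=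
  ⟨h, fun _ _ => rfl⟩

theorem map {T : ℕ} {f : ∀ X : BundledInstance p S C, X.V → α} (hf : LocallyComputable T f)
    (h : α → β) : LocallyComputable T (fun X v => h (f X v)) := by
  obtain ⟨g, hg⟩ := hf
  exact ⟨fun w => h (g w), fun X v => by simp only [hg]⟩

theorem prod {T : ℕ} {f : ∀ X : BundledInstance p S C, X.V → α}
    {f' : ∀ X : BundledInstance p S C, X.V → β} (hf : LocallyComputable T f)
    (hf' : LocallyComputable T f') : LocallyComputable T (fun X v => (f X v, f' X v)) := by
  obtain ⟨g, hg⟩ := hf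
  obtain ⟨g', hg'⟩ := hf'
  exact ⟨fun w => (g w, g' w), fun X v => by simp only [hg, hg']⟩

theorem succ {T : ℕ} {f : ∀ X : BundledInstance p S C, X.V → α} (hf : LocallyComputable T f) :
    LocallyComputable (T + 1) f := by
  obtain ⟨g, hg⟩ := hf
  exact ⟨fun w => g w.1, fun X v => by rw [hg]; rfl⟩

theorem mono {T T' : ℕ} (hT : T ≤ T') {f : ∀ X : BundledInstance p S C, X.V → α}
    (hf : LocallyComputable T f) : LocallyComputable T' f := by
  induction hT with
  | refl => exact hf
  | step _ ih => exact ih.succ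

theorem input (T : ℕ) : LocallyComputable T (fun (X : BundledInstance p S C) v => X.I.input v) :=
  (of_input id).mono (Nat.zero_le T)

/-- One round of communication makes the labels of all neighbors known. -/
theorem neighbors {T : ℕ} {f : ∀ X : BundledInstance p S C, X.V → α}
    (hf : LocallyComputable T f) :
    LocallyComputable (T + 1) (fun X v =>
      {a : ℕ × α | ∃ u, X.W.graph.Adj v u ∧ a = (X.W.ident u, f X u)}) := by
  obtain ⟨g, hg⟩ := hf
  refine ⟨fun w => {a | ∃ b ∈ w.2, a = (b.1, g b.2)}, fun X v => ?_⟩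
  ext a
  simp only [localView, Set.mem_ofPred_eq, hg]
  constructor
  · rintro ⟨u, hu, rfl⟩
    exact ⟨_, ⟨u, hu, rfl⟩, rfl⟩
  · rintro ⟨_, ⟨u, hu, rfl⟩, rfl⟩
    exact ⟨u, hu, rfl⟩

/-- One round of communication allows a node to count the neighbors whose labels have a given
property; identifiers are unique, so that no two neighbors are confused. -/
theorem neighborCount {T : ℕ} {f : ∀ X : BundledInstance p S C, X.V → α}
    (hf : LocallyComputable T f) :
    LocallyComputable (T + 1) (fun X v (P : α → Prop) =>
      {u | X.W.graph.Adj v u ∧ P (f X u)}.ncard) := by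
  convert hf.neighbors.map (fun M (P : α → Prop) => {a | a ∈ M ∧ P a.2}.ncard) using 1
  ext X v P
  rw [← Set.ncard_image_of_injective (f := fun u => (X.W.ident u, f X u)) _
    (fun u u' h => X.W.ident_injective (Prod.ext_iff.1 h).1)]
  congr 1
  ext a
  simp only [Set.mem_image, Set.mem_ofPred_eq]
  constructor
  · rintro ⟨u, ⟨h1, h2⟩, rfl⟩
    exact ⟨⟨u, h1, rfl⟩, h2⟩
  · rintro ⟨⟨u, h1, rfl⟩, h2⟩
    exact ⟨u, ⟨h1, h2⟩, rfl⟩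

end LocallyComputable

/-- The graph that keeps the edges of `G` inside the node set `H`; the other nodes become
isolated. -/
def SimpleGraph.restrictTo {V : Type} (G : SimpleGraph V) (H : V → Prop) : SimpleGraph V where
  Adj u v := G.Adj u v ∧ H u ∧ H v
  symm := ⟨fun _ _ h => ⟨h.1.symm, h.2.2, h.2.1⟩⟩
  loopless := ⟨fun _ h => h.1.ne rfl⟩

/-- An algorithm can be run on the subgraph induced by a locally computable set of nodes, with
locally computable inputs. -/
theorem LocallyComputable.stateAfter {R : ℕ} (A : LocalAlgorithm NodeInput α)
    {H : ∀ X : BundledInstance p S C, X.V → Prop}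
    {inp : ∀ X : BundledInstance p S C, X.V → NodeInput}
    (hH : LocallyComputable R H) (hinp : LocallyComputable R inp) (t : ℕ) :
    LocallyComputable (R + t) (fun X v =>
      A.stateAfter (X.W.graph.restrictTo (H X)) X.W.ident (inp X) t v) := by
  induction t with
  | zero => exact hinp.map A.init
  | succ t ih =>
    rw [← Nat.add_assoc]
    have hH' := hH.mono (Nat.le_add_right R t)
    convert ((ih.prod hH').succ.prod
      ((LocallyComputable.input _).prod (ih.prod hH').neighbors)).map
      (fun a => A.receive a.1.1 {b | ∃ s ∈ a.2.2, a.1.2 ∧ s.2.2 ∧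
        b = (s.1, A.send s.2.1 a.2.1.ident)}) using 1
    ext X v
    simp only [LocalAlgorithm.stateAfter]
    refine congrArg _ (Set.ext fun b => ?_)
    simp only [Set.mem_ofPred_eq, SimpleGraph.restrictTo]
    constructor
    · rintro ⟨u, ⟨h1, h2, h3⟩, rfl⟩
      exact ⟨_, ⟨u, h1, rfl⟩, h2, h3, rfl⟩
    · rintro ⟨_, ⟨u, h1, rfl⟩, h2, h3, rfl⟩
      exact ⟨u, ⟨h1, h2, h3⟩, rfl⟩

theorem LocallyComputable.run {R : ℕ} (A : LocalAlgorithm NodeInput α)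
    {H : ∀ X : BundledInstance p S C, X.V → Prop}
    {inp : ∀ X : BundledInstance p S C, X.V → NodeInput}
    (hH : LocallyComputable R H) (hinp : LocallyComputable R inp) (t : ℕ) :
    LocallyComputable (R + t) (fun X v =>
      A.run (X.W.graph.restrictTo (H X)) X.W.ident (inp X) t v) :=
  (LocallyComputable.stateAfter A hH hinp t).map A.output

/-- A locally computable family of solutions bounds the complexity of list defective coloring. -/
theorem TD_le_of_locallyComputable {T : ℕ} {x : ∀ X : BundledInstance p S C, X.V → ℕ}
    (hx : LocallyComputable T x)
    (h : ∀ X : BundledInstance p S C, X.I.IsDefectiveColoring (x X)) : TD p S C ≤ T := by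
  obtain ⟨g, hg⟩ := hx
  refine iInf₂_le T ⟨fullInformation T g, fun V _ W I => ?_⟩
  convert h ⟨V, W, I⟩ using 1
  ext v
  rw [fullInformation_run, hg]

/-! ### Bounded neighborhood independence -/

open Classical in
/-- If the edges inside a finite set `s` can be oriented with out-degrees at most `k`, then every
subset of `s` has a node of degree at most `2 * k`, and choosing such nodes greedily gives a large
independent set. -/
theorem SimpleGraph.exists_indep_of_orientation {V : Type} (G : SimpleGraph V) (O : V → V → Prop)
    (k : ℕ) (s : Finset V) (hO : ∀ u ∈ s, ∀ v ∈ s, G.Adj u v → O u v ∨ O v u)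
    (hk : ∀ v ∈ s, (s.filter fun u => G.Adj v u ∧ O v u).card ≤ k) :
    ∃ t ⊆ s, (∀ u ∈ t, ∀ v ∈ t, ¬ G.Adj u v) ∧ s.card ≤ (2 * k + 1) * t.card := by
  induction s using Finset.strongInduction with
  | H s ih =>
    rcases s.eq_empty_or_nonempty with rfl | hs
    · exact ⟨∅, by simp⟩
    -- by double counting, the average in-degree equals the average out-degree
    obtain ⟨v, hv, hvk⟩ : ∃ v ∈ s, (s.filter fun u => G.Adj u v ∧ O u v).card ≤ k := by
      refine Finset.exists_le_of_sum_le hs (g := fun _ => k) ?_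
      calc ∑ v ∈ s, (s.filter fun u => G.Adj u v ∧ O u v).card
          = ∑ v ∈ s, (s.filter fun u => G.Adj v u ∧ O v u).card :=
            Finset.sum_card_bipartiteAbove_eq_sum_card_bipartiteBelow
              (fun v u => G.Adj u v ∧ O u v)
        _ ≤ ∑ v ∈ s, k := Finset.sum_le_sum hk
    let N := s.filter fun u => u = v ∨ G.Adj v u
    have hN : N.card ≤ 2 * k + 1 := by
      have h1 : N ⊆ {v} ∪ (s.filter fun u => G.Adj v u ∧ O v u) ∪
          (s.filter fun u => G.Adj u v ∧ O u v) := by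
        intro u hu
        simp only [N, Finset.mem_filter, Finset.mem_union, Finset.mem_singleton] at hu ⊢
        rcases hu with ⟨hus, rfl | h⟩
        · exact Or.inl (Or.inl rfl)
        · rcases hO v hv u hus h with h' | h'
          · exact Or.inl (Or.inr ⟨hus, h, h'⟩)
          · exact Or.inr ⟨hus, h.symm, h'⟩
      have h2 := (Finset.card_le_card h1).trans (Finset.card_union_le _ _)
      have h3 := Finset.card_union_le {v} (s.filter fun u => G.Adj v u ∧ O v u)
      have h4 := hk v hv
      rw [Finset.card_singleton] at h3
      omega
    have hvN : v ∈ N := by simp [N, hv]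
    have hsub : s \ N ⊂ s :=
      Finset.ssubset_iff_of_subset Finset.sdiff_subset |>.2 ⟨v, hv, by simp [hvN]⟩
    obtain ⟨t, hts, ht, hcard⟩ := ih (s \ N) hsub
      (fun u hu v hv => hO u (hsub.1 hu) v (hsub.1 hv))
      (fun v hv => (Finset.card_le_card (Finset.filter_subset_filter _ hsub.1)).trans
        (hk v (hsub.1 hv)))
    have hvt : ∀ u ∈ t, ¬ G.Adj v u := fun u hu h => by
      have := Finset.mem_sdiff.1 (hts hu)
      exact this.2 (Finset.mem_filter.2 ⟨this.1, Or.inr h⟩)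
    have hvt' : v ∉ t := fun h => (Finset.mem_sdiff.1 (hts h)).2 hvN
    refine ⟨insert v t, Finset.insert_subset hv (hts.trans hsub.1), ?_, ?_⟩
    · intro u hu w hw
      rw [Finset.mem_insert] at hu hw
      rcases hu with rfl | hu <;> rcases hw with rfl | hw
      · exact G.irrefl
      · exact hvt w hw
      · exact fun h => hvt u hu h.symm
      · exact ht u hu w hw
    · rw [Finset.card_insert_of_notMem hvt', mul_add, mul_one]
      have := Finset.card_sdiff_add_card_eq_card (show N ⊆ s from Finset.filter_subset _ s)
      omega

theorem SimpleGraph.card_le_nbhdIndependence {V : Type} [Fintype V] (G : SimpleGraph V) (v : V)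
    (t : Finset V) (hv : ∀ u ∈ t, G.Adj v u) (ht : ∀ u ∈ t, ∀ w ∈ t, ¬ G.Adj u w) :
    t.card ≤ G.nbhdIndependence := by
  classical
  let t' : Finset (G.neighborSet v) := t.subtype (· ∈ G.neighborSet v)
  have h1 : t'.card = t.card := by
    rw [Finset.card_subtype]
    exact congrArg _ (Finset.filter_true_of_mem hv)
  have h2 : (G.induce (G.neighborSet v)).IsIndepSet (t' : Set (G.neighborSet v)) := by
    intro a ha b hb _ hab
    exact ht a (Finset.mem_subtype.1 ha) b (Finset.mem_subtype.1 hb) hab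
  rw [← h1]
  exact h2.card_le_indepNum.trans
    (Finset.le_sup (f := fun v : V => (G.induce (G.neighborSet v)).indepNum) (Finset.mem_univ v))

/-- The step from arbdefective to defective colorings. If the monochromatic edges are oriented
such that every node `v` has at most `D v` out-neighbors of its own color, and such that `D` does
not decrease along the orientation, then `v` has at most `3 * θ * D v` neighbors of its color:
the in-neighbors of `v` of its color induce a graph of out-degree at most `D v - 1` and thus of
independence number at least a `1 / (2 * D v - 1)` fraction of their number. -/
theorem SimpleGraph.ncard_sameColor_le {V : Type} [Fintype V] (G : SimpleGraph V) {θ : ℕ}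
    (hθ : G.nbhdIndependence ≤ θ) (hθ1 : 1 ≤ θ) (x : V → ℕ) (D : V → ℕ) (O : V → V → Prop)
    (hO : ∀ u v, G.Adj u v → x u = x v → O u v ∨ O v u)
    (hD : ∀ v, {u | G.Adj v u ∧ x u = x v ∧ O v u}.ncard ≤ D v)
    (hmono : ∀ v u, G.Adj v u → x u = x v → O v u → D v ≤ D u) (v : V) :
    {u | G.Adj v u ∧ x u = x v}.ncard ≤ 3 * θ * D v := by
  classical
  let s : Finset V := Finset.univ.filter fun u => G.Adj v u ∧ x u = x v ∧ O u v
  have hD' : ∀ w, (Finset.univ.filter fun u => G.Adj w u ∧ x u = x w ∧ O w u).card ≤ D w := by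
    intro w
    rw [← Set.ncard_coe_finset]
    simpa using hD w
  have hs : s.card ≤ θ * (2 * D v - 1) := by
    have hout : ∀ u ∈ s, (s.filter fun w => G.Adj u w ∧ O u w).card + 1 ≤ D v := by
      intro u hu
      simp only [s, Finset.mem_filter, Finset.mem_univ, true_and] at hu
      obtain ⟨h1, h2, h3⟩ := hu
      refine le_trans ?_ ((hD' u).trans (hmono u v h1.symm h2.symm h3))
      rw [← Finset.card_insert_of_notMem (a := v) (by simp [s])]
      refine Finset.card_le_card fun w hw => ?_
      simp only [s, Finset.mem_insert, Finset.mem_filter, Finset.mem_univ, true_and] at hw ⊢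
      rcases hw with rfl | ⟨⟨h4, h5, h6⟩, h7, h8⟩
      · exact ⟨h1.symm, h2.symm, h3⟩
      · exact ⟨h7, h5.trans h2.symm, h8⟩
    rcases s.eq_empty_or_nonempty with h0 | ⟨u₀, hu₀⟩
    · simp [h0]
    have hDv : 1 ≤ D v := (Nat.le_add_left 1 _).trans (hout u₀ hu₀)
    obtain ⟨t, hts, ht, hcard⟩ := G.exists_indep_of_orientation O (D v - 1) s
      (fun u hu w hw h => by
        simp only [s, Finset.mem_filter, Finset.mem_univ, true_and] at hu hw
        exact hO u w h (hu.2.1.trans hw.2.1.symm))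
      (fun u hu => by have := hout u hu; omega)
    have ht' : t.card ≤ θ := (G.card_le_nbhdIndependence v t
      (fun u hu => (Finset.mem_filter.1 (hts hu)).2.1) ht).trans hθ
    calc s.card ≤ (2 * (D v - 1) + 1) * t.card := hcard
      _ ≤ (2 * (D v - 1) + 1) * θ := Nat.mul_le_mul_left _ ht'
      _ = θ * (2 * D v - 1) := by rw [mul_comm]; congr 1; omega
  have hle : {u | G.Adj v u ∧ x u = x v}.ncard ≤ D v + s.card := by
    refine le_trans ?_ (Nat.add_le_add_right (hD' v) _)
    refine le_trans ?_ (Finset.card_union_le _ _)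
    rw [← Set.ncard_coe_finset]
    refine Set.ncard_le_ncard (fun u hu => ?_) (Finset.finite_toSet _)
    obtain ⟨h1, h2⟩ := hu
    simp only [s, Finset.coe_union, Finset.coe_filter, Finset.mem_univ, true_and, Set.mem_union,
      Set.mem_ofPred_eq]
    rcases hO v u h1 h2.symm with h | h
    · exact Or.inl ⟨h1, h2, h⟩
    · exact Or.inr ⟨h1, h2, h⟩
  have h1 : D v ≤ θ * D v := Nat.le_mul_of_pos_left _ hθ1
  have h2 : θ * (2 * D v - 1) ≤ θ * (2 * D v) := Nat.mul_le_mul_left _ (Nat.sub_le _ _)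
  calc _ ≤ D v + s.card := hle
    _ ≤ θ * D v + θ * (2 * D v) := by omega
    _ = 3 * θ * D v := by ring

theorem SimpleGraph.nbhdIndependence_restrictTo_le {V : Type} [Fintype V] (G : SimpleGraph V)
    (H : V → Prop) : (G.restrictTo H).nbhdIndependence ≤ G.nbhdIndependence := by
  classical
  refine Finset.sup_le fun v _ => ?_
  obtain ⟨t, ht⟩ :=
    ((G.restrictTo H).induce ((G.restrictTo H).neighborSet v)).exists_isNIndepSet_indepNum
  rw [← ht.card_eq, ← Finset.card_map (Function.Embedding.subtype _)]
  refine G.card_le_nbhdIndependence v _ (fun u hu => ?_) (fun u hu w hw h => ?_)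
  · obtain ⟨u, -, rfl⟩ := Finset.mem_map.1 hu
    exact u.2.1
  · obtain ⟨u, hu', rfl⟩ := Finset.mem_map.1 hu
    obtain ⟨w, hw', rfl⟩ := Finset.mem_map.1 hw
    -- both nodes are neighbors of `v` in the restricted graph, hence belong to `H`
    exact ht.isIndepSet hu' hw' (fun e => h.ne (congrArg Subtype.val e))
      (show G.Adj u w ∧ H u ∧ H w from ⟨h, u.2.2.2, w.2.2.2⟩)

open Classical in
theorem SimpleGraph.maxDegree_restrictTo_le {V : Type} [Fintype V] (G : SimpleGraph V)
    (H : V → Prop) : (G.restrictTo H).maxDegree ≤ G.maxDegree :=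
  SimpleGraph.maxDegree_mono (fun _ _ h => h.1)

/-- The network on the subgraph induced by `H`; nodes outside of `H` are kept as isolated
nodes. -/
def Network.restrictTo {p : NetworkParams} {V : Type} [Fintype V] (W : Network p V)
    (H : V → Prop) : Network p V where
  graph := W.graph.restrictTo H
  card_le := W.card_le
  maxDegree_le := (W.graph.maxDegree_restrictTo_le H).trans W.maxDegree_le
  nbhdIndependence_le := (W.graph.nbhdIndependence_restrictTo_le H).trans W.nbhdIndependence_le
  ident := W.ident
  ident_injective := W.ident_injective
  ident_lt := W.ident_lt
  initColor := ⟨W.initColor, fun h => W.initColor.valid h.1⟩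

theorem Network.deg_eq_ncard {p : NetworkParams} {V : Type} [Fintype V] (W : Network p V)
    (v : V) : W.deg v = {u | W.graph.Adj v u}.ncard := by
  classical
  rw [Network.deg, ← SimpleGraph.card_neighborFinset_eq_degree, ← Set.ncard_coe_finset]
  simp [SimpleGraph.neighborSet]

theorem Network.deg_le {p : NetworkParams} {V : Type} [Fintype V] (W : Network p V)
    (v : V) : W.deg v ≤ p.Δ := by
  classical
  refine le_trans ?_ W.maxDegree_le
  rw [Network.deg]
  exact SimpleGraph.degree_le_maxDegree _ v

/-! ### Defective color reduction -/

/-- Evaluations of the polynomials of degree at most `t` over `ZMod f`: `m` functions from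
`{0, …, f - 1}` to itself, any two of which agree at no more than `t` points. -/
theorem exists_few_agreements {f t m : ℕ} (hf : f.Prime) (hm : m ≤ f ^ (t + 1)) :
    ∃ P : ℕ → ℕ → ℕ, (∀ c a, P c a < f) ∧ ∀ c < m, ∀ c' < m, c ≠ c' →
      ((Finset.range f).filter fun a => P c a = P c' a).card ≤ t := by
  classical
  have : Fact f.Prime := ⟨hf⟩
  have hcard : Fintype.card (Fin m) ≤ Fintype.card (Fin (t + 1) → ZMod f) := by
    simpa [ZMod.card] using hm
  obtain ⟨e⟩ := Function.Embedding.nonempty_of_card_le hcard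
  let Q : ℕ → Polynomial (ZMod f) := fun c =>
    if h : c < m then ((Polynomial.degreeLTEquiv (ZMod f) (t + 1)).symm (e ⟨c, h⟩)).1 else 0
  refine ⟨fun c a => ((Q c).eval (a : ZMod f)).val, fun c a => ZMod.val_lt _, ?_⟩
  intro c hc c' hc' hne
  have hQ : Q c - Q c' ≠ 0 := by
    intro h0
    have h1 := sub_eq_zero.1 h0
    simp only [Q, hc, hc', dif_pos] at h1
    have h2 := e.injective (LinearEquiv.injective _ (Subtype.ext h1))
    exact hne (Fin.mk.inj h2)
  have hdeg : (Q c - Q c').natDegree ≤ t := by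
    have hmem : Q c - Q c' ∈ Polynomial.degreeLT (ZMod f) (t + 1) := by
      simp only [Q, hc, hc', dif_pos]
      exact Submodule.sub_mem _ (Subtype.property _) (Subtype.property _)
    rw [Polynomial.mem_degreeLT] at hmem
    have := (Polynomial.natDegree_lt_iff_degree_lt hQ).2 hmem
    omega
  calc ((Finset.range f).filter fun a : ℕ => ((Q c).eval (a : ZMod f)).val
        = ((Q c').eval (a : ZMod f)).val).card
      ≤ (Q c - Q c').roots.toFinset.card := by
        refine Finset.card_le_card_of_injOn (fun a : ℕ => (a : ZMod f)) ?_ ?_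
        · intro a ha
          have h := ZMod.val_injective f (Finset.mem_filter.1 ha).2
          simp [Polynomial.mem_roots hQ, Polynomial.IsRoot, h]
        · intro a ha b hb hab
          have ha' := Finset.mem_range.1 (Finset.mem_filter.1 ha).1
          have hb' := Finset.mem_range.1 (Finset.mem_filter.1 hb).1
          have h := congrArg ZMod.val hab
          rwa [ZMod.val_cast_of_lt ha', ZMod.val_cast_of_lt hb'] at h
    _ ≤ (Q c - Q c').roots.card := Multiset.toFinset_card_le _
    _ ≤ t := (Polynomial.card_roots' _).trans hdeg

/-- The defect of a labeling at the node `v`: the number of neighbors with the label of `v`. -/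
def SimpleGraph.conflicts {V : Type} (G : SimpleGraph V) (lab : V → ℕ) (v : V) : ℕ :=
  {u | G.Adj v u ∧ lab u = lab v}.ncard

/-- One round of defective color reduction. A node of color `c` picks an evaluation point at
which the polynomial of `c` agrees with few of the polynomials of the colors of its neighbors, and
takes the point together with the value there as its new color. For `f > t * Δ` this maps proper
colorings to proper colorings. -/
theorem LocallyComputable.colorReduction {R m f t : ℕ}
    {lab : ∀ X : BundledInstance p S C, X.V → ℕ} (hlab : LocallyComputable R lab)
    (hm : ∀ X v, lab X v < m) (hf : f.Prime) (hft : m ≤ f ^ (t + 1)) :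
    ∃ lab' : ∀ X : BundledInstance p S C, X.V → ℕ, LocallyComputable (R + 1) lab' ∧
      (∀ X v, lab' X v < f ^ 2) ∧
      ∀ (X : BundledInstance p S C) v, f * X.W.graph.conflicts (lab' X) v ≤
        f * X.W.graph.conflicts (lab X) v + t * X.W.deg v := by
  classical
  obtain ⟨P, hP, hagree⟩ := exists_few_agreements hf hft
  -- `cnt` is the function that counts the neighbors whose color has a given property
  let good : ℕ → ((ℕ → Prop) → ℕ) → ℕ → Prop := fun c cnt a =>
    a < f ∧ f * cnt (fun c' => c' ≠ c ∧ P c' a = P c a) ≤ t * cnt (fun _ => True)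
  let pick : ℕ → ((ℕ → Prop) → ℕ) → ℕ := fun c cnt =>
    if h : ∃ a, good c cnt a then h.choose else 0
  let cnt : ∀ X : BundledInstance p S C, X.V → (ℕ → Prop) → ℕ := fun X v Q =>
    {u | X.W.graph.Adj v u ∧ Q (lab X u)}.ncard
  have hpick : ∀ X v, good (lab X v) (cnt X v) (pick (lab X v) (cnt X v)) := by
    intro X v
    have hex : ∃ a, good (lab X v) (cnt X v) a := by
      let N := Finset.univ.filter fun u => X.W.graph.Adj v u ∧ lab X u ≠ lab X v
      have hcnt : ∀ a, cnt X v (fun c' => c' ≠ lab X v ∧ P c' a = P (lab X v) a) =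
          (N.filter fun u => P (lab X u) a = P (lab X v) a).card := by
        intro a
        rw [← Set.ncard_coe_finset]
        simp [cnt, N, Finset.filter_filter, and_assoc]
      have hdeg : cnt X v (fun _ => True) = X.W.deg v := by
        rw [Network.deg_eq_ncard]
        simp [cnt]
      have hN : N.card ≤ X.W.deg v := by
        rw [Network.deg_eq_ncard, ← Set.ncard_coe_finset]
        exact Set.ncard_le_ncard (fun u hu => (Finset.mem_filter.1 hu).2.1) (Set.toFinite _)
      have hsum : ∑ a ∈ Finset.range f, f * (N.filter fun u => P (lab X u) a =
          P (lab X v) a).card ≤ ∑ a ∈ Finset.range f, t * X.W.deg v := by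
        rw [← Finset.mul_sum, Finset.sum_const, Finset.card_range, smul_eq_mul]
        refine Nat.mul_le_mul_left _ ?_
        calc ∑ a ∈ Finset.range f, (N.filter fun u => P (lab X u) a = P (lab X v) a).card
            = ∑ u ∈ N, ((Finset.range f).filter fun a => P (lab X u) a = P (lab X v) a).card :=
              Finset.sum_card_bipartiteAbove_eq_sum_card_bipartiteBelow
                (fun a u => P (lab X u) a = P (lab X v) a)
          _ ≤ ∑ u ∈ N, t := Finset.sum_le_sum fun u hu =>
              hagree _ (hm X u) _ (hm X v) (Finset.mem_filter.1 hu).2.2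
          _ = N.card * t := by rw [Finset.sum_const, smul_eq_mul]
          _ ≤ t * X.W.deg v := by rw [mul_comm]; exact Nat.mul_le_mul_left _ hN
      obtain ⟨a, ha, hle⟩ := Finset.exists_le_of_sum_le
        (Finset.nonempty_range_iff.2 hf.ne_zero) hsum
      exact ⟨a, Finset.mem_range.1 ha, by rw [hcnt, hdeg]; exact hle⟩
    simp only [pick, dif_pos hex]
    exact hex.choose_spec
  refine ⟨fun X v => pick (lab X v) (cnt X v) * f + P (lab X v) (pick (lab X v) (cnt X v)),
    (hlab.succ.prod hlab.neighborCount).map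
      (fun b => pick b.1 b.2 * f + P b.1 (pick b.1 b.2)), fun X v => ?_, fun X v => ?_⟩
  · have h1 := (hpick X v).1
    have h2 := hP (lab X v) (pick (lab X v) (cnt X v))
    calc pick (lab X v) (cnt X v) * f + P (lab X v) (pick (lab X v) (cnt X v))
        < pick (lab X v) (cnt X v) * f + f := Nat.add_lt_add_left h2 _
      _ = (pick (lab X v) (cnt X v) + 1) * f := by ring
      _ ≤ f * f := Nat.mul_le_mul_right _ h1
      _ = f ^ 2 := (sq f).symm
  · have h2 := (hpick X v).2
    have hdeg : cnt X v (fun _ => True) = X.W.deg v := by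
      rw [Network.deg_eq_ncard]
      simp [cnt]
    rw [hdeg] at h2
    refine le_trans ?_ (Nat.add_le_add_left h2 _)
    rw [← Nat.mul_add]
    refine Nat.mul_le_mul_left _ (le_trans ?_ (Set.ncard_union_le _ _))
    refine Set.ncard_le_ncard (fun u hu => ?_) (Set.toFinite _)
    obtain ⟨hadj, he⟩ := hu
    by_cases hc : lab X u = lab X v
    · exact Or.inl ⟨hadj, hc⟩
    · refine Or.inr ⟨hadj, hc, ?_⟩
      have hu := hP (lab X u) (pick (lab X u) (cnt X u))
      have hv := hP (lab X v) (pick (lab X v) (cnt X v))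
      have h3 := congrArg (· / f) he
      have h4 := congrArg (· % f) he
      simp only [Nat.mul_add_mod_self_right, Nat.mod_eq_of_lt hu, Nat.mod_eq_of_lt hv] at h4
      simp only [Nat.add_div_of_dvd_right (Dvd.intro_left _ rfl), Nat.div_eq_of_lt hu,
        Nat.div_eq_of_lt hv, Nat.mul_div_cancel _ hf.pos, add_zero] at h3
      rw [← h3, h4, h3]

/-! ### Fast proper coloring -/

/-- A proper coloring with `2 ^ y` colors can be computed in `r` rounds. -/
def ProperlyColorable (p : NetworkParams) (S : ℝ) (C r y : ℕ) : Prop :=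
  ∃ lab : ∀ X : BundledInstance p S C, X.V → ℕ, LocallyComputable r lab ∧
    (∀ X v, lab X v < 2 ^ y) ∧ ∀ (X : BundledInstance p S C) v, X.W.graph.conflicts (lab X) v = 0

theorem ProperlyColorable.initial : ProperlyColorable p S C 0 p.q := by
  refine ⟨fun X v => (X.I.input v).initColor, LocallyComputable.of_input _, fun X v => ?_,
    fun X v => ?_⟩
  · exact (X.W.initColor v).2.trans Nat.lt_two_pow_self
  · rw [SimpleGraph.conflicts, Set.ncard_eq_zero (Set.toFinite _)]
    ext u
    simp only [Set.mem_ofPred_eq, Set.mem_empty_iff_false, iff_false, not_and]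
    exact fun h e => X.W.initColor.valid h (Fin.ext e.symm)

theorem ProperlyColorable.step {r y : ℕ} (hΔ : 1 ≤ p.Δ) (hy : 1 ≤ y)
    (h : ProperlyColorable p S C r y) :
    ProperlyColorable p S C (r + 1) (2 + 2 * (Nat.log 2 p.Δ + 1) + 2 * Nat.clog 2 y) := by
  obtain ⟨lab, hlab, hlt, hprop⟩ := h
  have hpos : p.Δ * y ≠ 0 := Nat.mul_ne_zero (by omega) (by omega)
  obtain ⟨f, hf, hf1, hf2⟩ := Nat.exists_prime_lt_and_le_two_mul _ hpos
  have hm : 2 ^ y ≤ f ^ (y + 1) :=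
    (Nat.pow_le_pow_right (by norm_num) (Nat.le_succ y)).trans
      (Nat.pow_le_pow_left hf.two_le _)
  obtain ⟨lab', hlab', hlt', hbad⟩ := hlab.colorReduction hlt hf hm
  refine ⟨lab', hlab', fun X v => (hlt' X v).trans_le ?_, fun X v => ?_⟩
  · have h1 : p.Δ ≤ 2 ^ (Nat.log 2 p.Δ + 1) := (Nat.lt_pow_succ_log_self (by norm_num) _).le
    have h2 : y ≤ 2 ^ Nat.clog 2 y := Nat.le_pow_clog (by norm_num) _
    calc f ^ 2 ≤ (2 * (2 ^ (Nat.log 2 p.Δ + 1) * 2 ^ Nat.clog 2 y)) ^ 2 :=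
          Nat.pow_le_pow_left (hf2.trans (Nat.mul_le_mul_left _ (Nat.mul_le_mul h1 h2))) _
      _ = _ := by ring
  · have h1 := hbad X v
    rw [hprop X v, mul_zero, zero_add] at h1
    have h2 : y * X.W.deg v < f := by
      refine lt_of_le_of_lt ?_ hf1
      rw [mul_comm]
      exact Nat.mul_le_mul_right _ (X.W.deg_le v)
    by_contra h0
    exact absurd (Nat.le_mul_of_pos_right f (Nat.pos_of_ne_zero h0)) (by omega)

/-- Each color reduction round roughly replaces the number of bits `y` of the colors by its
logarithm, as long as `y` is large compared to `log Δ`. Hence the number of rounds until `y` is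
`O(log Δ)` is bounded by the number of logarithms that bring `z ≥ y / 16` below `1`. -/
theorem ProperlyColorable.iterate (hΔ : 1 ≤ p.Δ) (k : ℕ) : ∀ (z : ℝ) (r y : ℕ),
    (Real.logb 2)^[k] z ≤ 1 → 1 ≤ y → (y : ℝ) ≤ 16 * z → ProperlyColorable p S C r y →
    ∃ r' ≤ r + k, ∃ y' ≤ 64 * (Nat.log 2 p.Δ + 1), ProperlyColorable p S C r' y' := by
  induction k with
  | zero =>
    intro z r y hz hy hyz h
    refine ⟨r, le_rfl, y, ?_, h⟩
    have : (y : ℝ) ≤ 16 := by simp only [Function.iterate_zero, id] at hz; linarith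
    have : y ≤ 16 := by exact_mod_cast this
    omega
  | succ k ih =>
    intro z r y hz hy hyz h
    rw [Function.iterate_succ_apply] at hz
    by_cases hz4 : z < 4
    · refine ⟨r, by omega, y, ?_, h⟩
      have : (y : ℝ) < 64 := by linarith
      have : y < 64 := by exact_mod_cast this
      omega
    push Not at hz4
    have h' := h.step hΔ hy
    have hL : 2 ≤ Real.logb 2 z := by
      rw [Real.le_logb_iff_rpow_le (by norm_num) (by linarith)]
      norm_num
      exact hz4
    have hclog : (Nat.clog 2 y : ℝ) ≤ 5 + Real.logb 2 z := by
      have hy1 : (1 : ℝ) ≤ y := by exact_mod_cast hy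
      have h1 : (Nat.clog 2 y : ℝ) < Real.logb 2 y + 1 := by
        have := Nat.ceil_lt_add_one (Real.logb_nonneg (b := 2) (by norm_num) hy1)
        rwa [show ⌈Real.logb 2 (y : ℝ)⌉₊ = Nat.clog 2 y from Real.natCeil_logb_natCast 2 y] at this
      have h2 : Real.logb 2 y ≤ Real.logb 2 (16 * z) :=
        Real.logb_le_logb_of_le (by norm_num) (by linarith) hyz
      have h3 : Real.logb 2 (16 * z) = 4 + Real.logb 2 z := by
        rw [Real.logb_mul (by norm_num) (by linarith)]
        congr 1
        rw [Real.logb_eq_iff_rpow_eq (by norm_num) (by norm_num) (by norm_num)]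
        norm_num
      linarith
    set ℓ := Nat.log 2 p.Δ + 1 with hℓ
    have hℓ1 : 1 ≤ ℓ := by omega
    have hcast : ((2 + 2 * ℓ + 2 * Nat.clog 2 y : ℕ) : ℝ) =
        2 + 2 * (ℓ : ℝ) + 2 * (Nat.clog 2 y : ℝ) := by push_cast; ring
    rcases le_total (ℓ : ℝ) (Real.logb 2 z) with hle | hle
    · obtain ⟨r', hr', y', hy', h''⟩ := ih (Real.logb 2 z) (r + 1) _ hz (by omega)
        (by rw [hcast]; linarith) h'
      exact ⟨r', by omega, y', hy', h''⟩
    · refine ⟨r + 1, by omega, _, ?_, h'⟩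
      have hℓ1' : (1 : ℝ) ≤ ℓ := by exact_mod_cast hℓ1
      have : ((2 + 2 * ℓ + 2 * Nat.clog 2 y : ℕ) : ℝ) ≤ ((64 * ℓ : ℕ) : ℝ) := by
        rw [hcast]; push_cast; linarith
      exact_mod_cast this

/-- The set whose infimum defines `logStar q` is nonempty. -/
theorem exists_iterate_logb_le_one (n : ℕ) :
    ∀ x : ℝ, x ≤ n → ∃ k, (Real.logb 2)^[k] x ≤ 1 := by
  induction n with
  | zero =>
    intro x hx
    refine ⟨0, ?_⟩
    push_cast at hx
    exact hx.trans zero_le_one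
  | succ n ih =>
    intro x hx
    rcases le_total x 2 with h2 | h2
    · rcases le_total x 1 with h1 | h1
      · exact ⟨0, h1⟩
      · refine ⟨1, ?_⟩
        rw [Function.iterate_one, Real.logb_le_iff_le_rpow (by norm_num) (by linarith)]
        simpa using h2
    · obtain ⟨k, hk⟩ := ih (Real.logb 2 x) (by
        have hb := one_add_mul_self_le_rpow_one_add (s := 1) (by norm_num)
          (p := x - 1) (by linarith)
        have : Real.logb 2 x ≤ x - 1 := by
          rw [Real.logb_le_iff_le_rpow (by norm_num) (by linarith)]
          norm_num at hb
          linarith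
        push_cast at hx
        linarith)
      exact ⟨k + 1, by rwa [Function.iterate_succ_apply]⟩

theorem iterate_logb_logStar_le (q : ℕ) : (Real.logb 2)^[logStar q] (q : ℝ) ≤ 1 :=
  Nat.sInf_mem (s := {k : ℕ | (Real.logb 2)^[k] (q : ℝ) ≤ 1})
    (exists_iterate_logb_le_one q q le_rfl)

/-- A defective coloring with `O(log² Δ)` colors in which only a `1 / (⌊log Δ⌋ + 1)` fraction of
the neighbors of each node shares its color. Two color reductions follow upon the fast proper
coloring: one with polynomials of degree `O(log Δ)`, which leaves `O(log⁴ Δ)` colors, and one with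
polynomials of degree `3`. -/
theorem exists_defective_base_coloring (p : NetworkParams) (S : ℝ) (C : ℕ) (hΔ : 1 ≤ p.Δ)
    (hq : 1 ≤ p.q) :
    ∃ lab : ∀ X : BundledInstance p S C, X.V → ℕ, LocallyComputable (logStar p.q + 2) lab ∧
      (∀ X v, lab X v < 1024 * (Nat.log 2 p.Δ + 1) ^ 2) ∧
      ∀ (X : BundledInstance p S C) v,
        (Nat.log 2 p.Δ + 1) * X.W.graph.conflicts (lab X) v ≤ X.W.deg v := by
  have hq1 : (1 : ℝ) ≤ p.q := by exact_mod_cast hq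
  obtain ⟨r, hr, y, hy, lab, hlab, hlt, hprop⟩ := ProperlyColorable.iterate (S := S) (C := C) hΔ _
    (p.q : ℝ) 0 p.q (iterate_logb_logStar_le p.q) hq (by linarith) ProperlyColorable.initial
  set ℓ := Nat.log 2 p.Δ + 1 with hℓ
  have hℓ1 : 1 ≤ ℓ := by omega
  obtain ⟨f, hf, hf1, hf2⟩ := Nat.exists_prime_lt_and_le_two_mul (128 * ℓ ^ 2) (by positivity)
  have hm : 2 ^ y ≤ f ^ (64 * ℓ + 1) :=
    (Nat.pow_le_pow_right (by norm_num) (hy.trans (Nat.le_succ _))).trans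
      (Nat.pow_le_pow_left hf.two_le _)
  obtain ⟨lab₁, hlab₁, hlt₁, hbad₁⟩ := hlab.colorReduction hlt hf hm
  obtain ⟨f', hf', hf'1, hf'2⟩ := Nat.exists_prime_lt_and_le_two_mul (16 * ℓ) (by positivity)
  have hm' : f ^ 2 ≤ f' ^ (3 + 1) :=
    calc f ^ 2 ≤ (2 * (128 * ℓ ^ 2)) ^ 2 := Nat.pow_le_pow_left hf2 _
      _ = (16 * ℓ) ^ (3 + 1) := by ring
      _ ≤ f' ^ (3 + 1) := Nat.pow_le_pow_left hf'1.le _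
  obtain ⟨lab₂, hlab₂, hlt₂, hbad₂⟩ := hlab₁.colorReduction hlt₁ hf' hm'
  refine ⟨lab₂, hlab₂.mono (by omega), fun X v => (hlt₂ X v).trans_le ?_, fun X v => ?_⟩
  · calc f' ^ 2 ≤ (2 * (16 * ℓ)) ^ 2 := Nat.pow_le_pow_left hf'2 _
      _ = 1024 * ℓ ^ 2 := by ring
  · have h1 := hbad₁ X v
    rw [hprop X v, mul_zero, zero_add] at h1
    have h2 := hbad₂ X v
    set b := X.W.graph.conflicts (lab₁ X) v
    set b' := X.W.graph.conflicts (lab₂ X) v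
    set d := X.W.deg v
    have h3 : 2 * ℓ * b ≤ d := by
      have h4 : (64 * ℓ) * (2 * ℓ * b) ≤ (64 * ℓ) * d :=
        calc (64 * ℓ) * (2 * ℓ * b) = 128 * ℓ ^ 2 * b := by ring
          _ ≤ f * b := Nat.mul_le_mul_right _ hf1.le
          _ ≤ _ := h1
      exact Nat.le_of_mul_le_mul_left h4 (by omega)
    have h5 : (2 * f') * (ℓ * b') ≤ (2 * f') * d :=
      calc (2 * f') * (ℓ * b') = 2 * ℓ * (f' * b') := by ring
        _ ≤ 2 * ℓ * (f' * b + 3 * d) := Nat.mul_le_mul_left _ h2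
        _ = f' * (2 * ℓ * b) + 6 * ℓ * d := by ring
        _ ≤ f' * d + f' * d :=
          Nat.add_le_add (Nat.mul_le_mul_left _ h3) (Nat.mul_le_mul_right _ (by omega))
        _ = (2 * f') * d := by ring
    exact Nat.le_of_mul_le_mul_left h5 (by have := hf'.pos; omega)

/-! ### Levels of defects -/

/-- The level of a defect `d`: arbdefective coloring with out-degree `2 ^ defectLevel θ d - 1`
suffices for defect `d` in graphs of neighborhood independence `θ`. -/
def defectLevel (θ d : ℕ) : ℕ := Nat.log 2 (d / (3 * θ) + 1)

theorem three_mul_pow_defectLevel_le (θ d : ℕ) : 3 * θ * (2 ^ defectLevel θ d - 1) ≤ d := by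
  have h : 2 ^ defectLevel θ d ≤ d / (3 * θ) + 1 := Nat.pow_log_le_self 2 (Nat.succ_ne_zero _)
  exact (Nat.mul_le_mul_left _ (Nat.sub_le_of_le_add h)).trans (Nat.mul_div_le d (3 * θ))

theorem succ_le_six_mul_pow_defectLevel {θ : ℕ} (hθ : 1 ≤ θ) (d : ℕ) :
    d + 1 ≤ 6 * θ * 2 ^ defectLevel θ d := by
  have h1 : d / (3 * θ) + 1 < 2 ^ (defectLevel θ d + 1) :=
    Nat.lt_pow_succ_log_self (by norm_num) _
  calc d + 1 ≤ 3 * θ * (d / (3 * θ) + 1) := Nat.lt_mul_div_succ d (by omega)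
    _ ≤ 3 * θ * 2 ^ (defectLevel θ d + 1) := Nat.mul_le_mul_left _ h1.le
    _ = 6 * θ * 2 ^ defectLevel θ d := by ring

theorem defectLevel_lt {θ d Δ : ℕ} (h : d < Δ) : defectLevel θ d < Nat.log 2 Δ + 1 := by
  refine Nat.lt_succ_of_le (Nat.log_mono_right ?_)
  have := Nat.div_le_self d (3 * θ)
  omega

/-- The number of neighbors of `v` that have already received the color `x`. -/
def SimpleGraph.usedCount {V : Type} (G : SimpleGraph V) (col : V → Option ℕ) (v : V) (x : ℕ) :
    ℕ :=
  {u | G.Adj v u ∧ col u = some x}.ncard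

/-- The total weight that the colors of level `i` in the list `L` have left, if `a x` neighbors
have already received the color `x`. -/
def levelWeight (θ : ℕ) (L : Finset ℕ) (d : ℕ → ℕ) (i : ℕ) (a : ℕ → ℕ) : ℕ :=
  ∑ x ∈ L.filter (fun x => defectLevel θ (d x) = i), (2 ^ i - a x)

theorem levelWeight_antitone {θ : ℕ} {L : Finset ℕ} {d : ℕ → ℕ} {i : ℕ} {a a' : ℕ → ℕ}
    (h : ∀ x, a x ≤ a' x) : levelWeight θ L d i a' ≤ levelWeight θ L d i a :=
  Finset.sum_le_sum fun x _ => Nat.sub_le_sub_left (h x) _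

/-! ### A single phase -/

open Classical in
/-- The list arbdefective coloring instance of a phase of level `i`: the participating nodes `H`
use the colors of level `i` whose defect is not yet exhausted by the `a v x` neighbors of color
`x`. The other nodes are isolated and get a dummy list. -/
def ListInstance.levelInstance {V : Type} [Fintype V] {W : Network p V} (I : ListInstance W S' C)
    (S : ℝ) (hC : 0 < C) (i : ℕ) (H : V → Prop) (a : V → ℕ → ℕ)
    (hH : ∀ v, H v → S * ((W.restrictTo H).deg v : ℝ) <
      (levelWeight p.θ (I.L v) (I.d v) i (a v) : ℝ)) :
    ListInstance (W.restrictTo H) S C where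
  L v := if H v then (I.L v).filter (fun x => defectLevel p.θ (I.d v x) = i ∧ a v x < 2 ^ i)
    else {0}
  d v x := 2 ^ i - 1 - a v x
  list_subset v := by
    split_ifs
    · exact (Finset.filter_subset _ _).trans (I.list_subset v)
    · simpa using hC
  slack v := by
    by_cases hv : H v
    · refine (hH v hv).trans_eq ?_
      rw [if_pos hv, levelWeight, Nat.cast_sum, ← Finset.filter_filter, Finset.sum_filter
        (fun x => a v x < 2 ^ i)]
      refine Finset.sum_congr rfl fun x _ => ?_
      split_ifs with h
      · rw [← Nat.cast_succ]
        congr 1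
        omega
      · rw [Nat.sub_eq_zero_of_le (by omega), Nat.cast_zero]
    · have h0 : (W.restrictTo H).deg v = 0 := by
        rw [Network.deg_eq_ncard, Set.ncard_eq_zero (Set.toFinite _)]
        ext u
        simp only [Set.mem_ofPred_eq, Set.mem_empty_iff_false, iff_false]
        exact fun h => hv h.2.1
      rw [h0, if_neg hv, Finset.sum_singleton, Nat.cast_zero, mul_zero]
      positivity

/-- What a phase with level `i` and base color `k` achieves, when it extends the partial coloring
`col` to `col'`: the nodes of base color `k` that stay uncolored have little weight left on level
`i`, and every newly colored node has, among the previously colored neighbors and the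
out-neighbors with respect to a suitable orientation, less than `2 ^ i` of its own color. -/
structure PhaseStep {V : Type} [Fintype V] {W : Network p V} (I : ListInstance W S' C)
    (S : ℝ) (lab : V → ℕ) (i k : ℕ) (col col' : V → Option ℕ) : Prop where
  keep : ∀ v x, col v = some x → col' v = some x
  blocked : ∀ v, col' v = none → lab v = k →
    (levelWeight p.θ (I.L v) (I.d v) i (W.graph.usedCount col v) : ℝ) ≤
      S * (W.graph.conflicts lab v : ℝ)
  orientation : ∃ O : V → V → Prop,
    (∀ u v x, W.graph.Adj u v → col u = none → col v = none → col' u = some x →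
      col' v = some x → O u v ∨ O v u) ∧
    ∀ v x, col v = none → col' v = some x → x ∈ I.L v ∧ defectLevel p.θ (I.d v x) = i ∧
      W.graph.usedCount col v x +
        {u | W.graph.Adj v u ∧ col u = none ∧ col' u = some x ∧ O v u}.ncard + 1 ≤ 2 ^ i

/-- A phase takes one round to learn the colors of the neighbors, one round to learn which
neighbors participate, and one run of the arbdefective coloring algorithm. -/
theorem exists_phaseStep {A : LocalAlgorithm NodeInput ArbOutput} {T : ℕ}
    (hA : SolvesArbdefective p S C T A) (hS : 0 ≤ S) (hC : 0 < C) {R : ℕ}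
    {lab : ∀ X : BundledInstance p S' C, X.V → ℕ}
    {col : ∀ X : BundledInstance p S' C, X.V → Option ℕ}
    (hlab : LocallyComputable R lab) (hcol : LocallyComputable R col) (i k : ℕ) :
    ∃ col' : ∀ X : BundledInstance p S' C, X.V → Option ℕ,
      LocallyComputable (R + 2 + T) col' ∧
      ∀ X, PhaseStep X.I S (lab X) i k (col X) (col' X) := by
  classical
  -- the participating nodes
  let H : ∀ X : BundledInstance p S' C, X.V → Prop := fun X v =>
    col X v = none ∧ lab X v = k ∧ S * (X.W.graph.conflicts (lab X) v : ℝ) <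
      (levelWeight p.θ (X.I.L v) (X.I.d v) i (X.W.graph.usedCount (col X) v) : ℝ)
  have hused : LocallyComputable (R + 1) (fun (X : BundledInstance p S' C) v =>
      X.W.graph.usedCount (col X) v) :=
    hcol.neighborCount.map (fun cnt x => cnt (fun c => c = some x))
  have hconf : LocallyComputable (R + 1) (fun (X : BundledInstance p S' C) v =>
      X.W.graph.conflicts (lab X) v) :=
    (hlab.succ.prod hlab.neighborCount).map (fun b => b.2 (fun c => c = b.1))
  have hH : LocallyComputable (R + 1) H :=
    ((hcol.prod hlab).succ.prod ((LocallyComputable.input _).prod (hused.prod hconf))).map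
      (fun b => b.1.1 = none ∧ b.1.2 = k ∧ S * (b.2.2.2 : ℝ) <
        (levelWeight p.θ b.2.1.list b.2.1.defect i b.2.2.1 : ℝ))
  have hdeg : ∀ (X : BundledInstance p S' C) v, (X.W.restrictTo (H X)).deg v =
      if H X v then {u | X.W.graph.Adj v u ∧ H X u}.ncard else 0 := by
    intro X v
    rw [Network.deg_eq_ncard]
    split_ifs with hv
    · congr 1
      ext u
      exact ⟨fun h => ⟨h.1, h.2.2⟩, fun h => ⟨h.1, hv, h.2⟩⟩
    · rw [Set.ncard_eq_zero (Set.toFinite _)]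
      ext u
      simp only [Set.mem_ofPred_eq, Set.mem_empty_iff_false, iff_false]
      exact fun h => hv h.2.1
  have hslack : ∀ (X : BundledInstance p S' C) v, H X v →
      S * ((X.W.restrictTo (H X)).deg v : ℝ) <
        (levelWeight p.θ (X.I.L v) (X.I.d v) i (X.W.graph.usedCount (col X) v) : ℝ) := by
    intro X v hv
    refine lt_of_le_of_lt (mul_le_mul_of_nonneg_left ?_ hS) hv.2.2
    rw [hdeg, if_pos hv, Nat.cast_le]
    -- all participating nodes have the base color `k`
    exact Set.ncard_le_ncard (fun u hu => ⟨hu.1, hu.2.2.1.trans hv.2.1.symm⟩) (Set.toFinite _)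
  let J : ∀ X : BundledInstance p S' C, ListInstance (X.W.restrictTo (H X)) S C := fun X =>
    X.I.levelInstance S hC i (H X) (X.W.graph.usedCount (col X)) (hslack X)
  have hJ : LocallyComputable (R + 2) (fun X => (J X).input) := by
    convert ((LocallyComputable.input (R + 2)).prod ((hused.prod hH).succ.prod
      hH.neighborCount)).map (fun b => NodeInput.mk b.1.ident b.1.initColor
        (if b.2.1.2 then b.2.2 (fun h => h) else 0)
        (if b.2.1.2 then b.1.list.filter
          (fun x => defectLevel p.θ (b.1.defect x) = i ∧ b.2.1.1 x < 2 ^ i) else {0})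
        (fun x => 2 ^ i - 1 - b.2.1.1 x)) using 1
    ext X v
    simp only [ListInstance.input, hdeg]
    rfl
  let y : ∀ X : BundledInstance p S' C, X.V → ArbOutput := fun X =>
    A.run (X.W.graph.restrictTo (H X)) X.W.ident (J X).input T
  have hy : LocallyComputable (R + 2 + T) y := LocallyComputable.run A hH.succ hJ T
  have hsol : ∀ X, (J X).IsArbdefectiveColoring (y X) := fun X => hA X.V _ (J X)
  let update : Prop → ℕ → Option ℕ → Option ℕ := fun h x c => if h then some x else c
  let col' : ∀ X : BundledInstance p S' C, X.V → Option ℕ := fun X v =>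
    update (H X v) (y X v).color (col X v)
  have hpos : ∀ X v, H X v → col' X v = some (y X v).color := fun X v hv => if_pos hv
  have hneg : ∀ X v, ¬ H X v → col' X v = col X v := fun X v hv => if_neg hv
  refine ⟨col', ?_, fun X => ?_⟩
  · exact ((hH.mono (by omega)).prod (hy.prod (hcol.mono (by omega)))).map
      (fun b => update b.1 b.2.1.color b.2.2)
  obtain ⟨hlist, hxor, hout⟩ := hsol X
  -- a newly colored node participates
  have hnew : ∀ v x, col X v = none → col' X v = some x →
      H X v ∧ (y X v).color = x := by
    intro v x h1 h2
    by_cases hv : H X v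
    · rw [hpos X v hv] at h2
      exact ⟨hv, Option.some.inj h2⟩
    · rw [hneg X v hv, h1] at h2
      exact absurd h2 (by simp)
  refine ⟨fun v x hv => ?_, fun v hv hk => ?_, fun v u => X.W.ident u ∈ (y X v).out,
    fun u v x huv hu hv hu' hv' => ?_, fun v x hv hv' => ?_⟩
  · rw [hneg X v fun h => by simp [h.1] at hv]
    exact hv
  · by_cases h : H X v
    · exact absurd ((hpos X v h).symm.trans hv) (by simp)
    · rw [hneg X v h] at hv
      by_contra hlt
      exact h ⟨hv, hk, not_le.1 hlt⟩
  · obtain ⟨h1, rfl⟩ := hnew u x hu hu'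
    obtain ⟨h2, h3⟩ := hnew v _ hv hv'
    rcases hxor u v ⟨huv, h1, h2⟩ h3.symm with h | h
    · exact Or.inl h.1
    · exact Or.inr h.1
  · obtain ⟨h1, rfl⟩ := hnew v x hv hv'
    have hmem := hlist v
    simp only [J, ListInstance.levelInstance, if_pos h1, Finset.mem_filter] at hmem
    refine ⟨hmem.1, hmem.2.1, ?_⟩
    have h2 : {u | X.W.graph.Adj v u ∧ col X u = none ∧
        col' X u = some (y X v).color ∧
        X.W.ident u ∈ (y X v).out}.ncard ≤
        2 ^ i - 1 - X.W.graph.usedCount (col X) v (y X v).color := by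
      refine le_trans (Set.ncard_le_ncard (fun u hu => ?_) (Set.toFinite _)) (hout v)
      obtain ⟨h3, h4, h5, h6⟩ := hu
      obtain ⟨h7, h8⟩ := hnew u _ h4 h5
      exact ⟨⟨h3, h1, h7⟩, h8, h6⟩
    have h3 := hmem.2.2
    rw [Nat.le_sub_iff_add_le (by omega)] at h2
    simp only at h2 ⊢
    omega

/-! ### The sequence of all phases -/

/-- The invariant before phase `j`, where phase `j` treats the level `ℓ - 1 - j / K` and the base
color `j % K`. The values `D v` are upper bounds on the out-degrees of the colored nodes `v` in
their color classes; since the levels are treated in decreasing order, they do not decrease along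
the orientation. The nodes that tolerate all their neighbors are colored from the beginning and
have `D v = Δ`. -/
structure PhaseInvariant {V : Type} [Fintype V] {W : Network p V} (I : ListInstance W S' C)
    (S : ℝ) (lab : V → ℕ) (ℓ K j : ℕ) (col : V → Option ℕ) : Prop where
  defect_lt : ∀ v, col v = none → ∀ x ∈ I.L v, I.d v x < W.deg v
  blocked : ∀ v, col v = none → ∀ j' < j, j' % K = lab v →
    (levelWeight p.θ (I.L v) (I.d v) (ℓ - 1 - j' / K) (W.graph.usedCount col v) : ℝ) ≤
      S * (W.graph.conflicts lab v : ℝ)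
  orientation : ∃ (O : V → V → Prop) (D : V → ℕ),
    (∀ u v x, W.graph.Adj u v → col u = some x → col v = some x → O u v ∨ O v u) ∧
    ∀ v x, col v = some x → x ∈ I.L v ∧ (W.deg v ≤ I.d v x ∨ 3 * p.θ * D v ≤ I.d v x) ∧
      2 ^ (ℓ - 1 - j / K) ≤ D v + 1 ∧
      {u | W.graph.Adj v u ∧ col u = some x ∧ O v u}.ncard ≤ D v ∧
      ∀ u, W.graph.Adj v u → col u = some x → O v u → D v ≤ D u

theorem PhaseInvariant.succ {V : Type} [Fintype V] {W : Network p V} {I : ListInstance W S' C}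
    {lab : V → ℕ} {ℓ K j : ℕ} {col col' : V → Option ℕ} (h : PhaseInvariant I S lab ℓ K j col)
    (hstep : PhaseStep I S lab (ℓ - 1 - j / K) (j % K) col col') :
    PhaseInvariant I S lab ℓ K (j + 1) col' := by
  classical
  have hnone : ∀ v, col' v = none → col v = none := by
    intro v hv
    cases hc : col v with
    | none => rfl
    | some x => rw [hstep.keep v x hc] at hv; exact absurd hv (by simp)
  have hused : ∀ v x, W.graph.usedCount col v x ≤ W.graph.usedCount col' v x := fun v x =>
    Set.ncard_le_ncard (fun u hu => ⟨hu.1, hstep.keep u x hu.2⟩) (Set.toFinite _)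
  have hold : ∀ v x, col v ≠ none → col' v = some x → col v = some x := by
    intro v x h1 h2
    obtain ⟨z, hz⟩ := Option.ne_none_iff_exists'.1 h1
    rw [hz, ← h2, hstep.keep v z hz]
  refine ⟨fun v hv => h.defect_lt v (hnone v hv), fun v hv j' hj' hlab => ?_, ?_⟩
  · refine le_trans (Nat.cast_le.2 (levelWeight_antitone (hused v))) ?_
    rcases Nat.lt_succ_iff_lt_or_eq.1 hj' with hlt | rfl
    · exact h.blocked v (hnone v hv) j' hlt hlab
    · exact hstep.blocked v hv hlab.symm
  · obtain ⟨O, D, hO, hD⟩ := h.orientation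
    obtain ⟨O', hO', hD'⟩ := hstep.orientation
    set i := ℓ - 1 - j / K with hi
    have hi' : 2 ^ (ℓ - 1 - (j + 1) / K) ≤ 2 ^ i :=
      Nat.pow_le_pow_right (by norm_num)
        (Nat.sub_le_sub_left (Nat.div_le_div_right (Nat.le_succ j)) _)
    have hpos : 1 ≤ 2 ^ i := Nat.one_le_two_pow
    -- edges between old and new nodes are directed towards the old nodes
    refine ⟨fun v u => (col v ≠ none ∧ col u ≠ none ∧ O v u) ∨
      (col v = none ∧ (col u ≠ none ∨ O' v u)), fun v => if col v = none then 2 ^ i - 1 else D v,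
      fun u v x huv hu hv => ?_, fun v x hv => ?_⟩
    · by_cases hcu : col u = none <;> by_cases hcv : col v = none
      · rcases hO' u v x huv hcu hcv hu hv with h1 | h1
        · exact Or.inl (Or.inr ⟨hcu, Or.inr h1⟩)
        · exact Or.inr (Or.inr ⟨hcv, Or.inr h1⟩)
      · exact Or.inl (Or.inr ⟨hcu, Or.inl hcv⟩)
      · exact Or.inr (Or.inr ⟨hcv, Or.inl hcu⟩)
      · rcases hO u v x huv (hold u x hcu hu) (hold v x hcv hv) with h1 | h1
        · exact Or.inl (Or.inl ⟨hcu, hcv, h1⟩)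
        · exact Or.inr (Or.inl ⟨hcv, hcu, h1⟩)
    · by_cases hcv : col v = none
      · obtain ⟨h1, h2, h3⟩ := hD' v x hcv hv
        simp only [hcv, if_true]
        refine ⟨h1, Or.inr ?_, by omega, ?_, fun u _ hu _ => ?_⟩
        · rw [← h2]
          exact three_mul_pow_defectLevel_le _ _
        · refine le_trans ?_ (Nat.le_sub_one_of_lt (Nat.lt_of_succ_le h3))
          refine le_trans (Set.ncard_le_ncard (fun u hu => ?_) (Set.toFinite _))
            (Set.ncard_union_le _ _)
          obtain ⟨h4, h5, h6⟩ := hu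
          by_cases hcu : col u = none
          · refine Or.inr ⟨h4, hcu, h5, ?_⟩
            simpa [hcu] using h6
          · exact Or.inl ⟨h4, hold u x hcu h5⟩
        · split_ifs with hcu
          · exact le_rfl
          · have := (hD u x (hold u x hcu hu)).2.2.1
            omega
      · obtain ⟨h1, h2, h3, h4, h5⟩ := hD v x (hold v x hcv hv)
        simp only [hcv, if_false]
        refine ⟨h1, h2, hi'.trans h3, ?_, fun u huv hu hO => ?_⟩
        · refine le_trans (Set.ncard_le_ncard (fun u hu => ?_) (Set.toFinite _)) h4
          obtain ⟨h6, h7, h8⟩ := hu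
          simp only [ne_eq, not_false_eq_true, true_and, false_and, or_false, hcv] at h8
          exact ⟨h6, hold u x h8.1 h7, h8.2⟩
        · simp only [ne_eq, not_false_eq_true, true_and, false_and, or_false, hcv] at hO
          rw [if_neg hO.1]
          exact h5 u huv (hold u x hO.1 hu) hO.2

/-- Every colored neighbor uses up one unit of the weight of a single color. -/
theorem Network.sum_usedCount_le {V : Type} [Fintype V] (W : Network p V) (col : V → Option ℕ)
    (v : V) (L : Finset ℕ) : ∑ x ∈ L, W.graph.usedCount col v x ≤ W.deg v := by
  classical
  let N := Finset.univ.filter fun u => W.graph.Adj v u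
  have hN : N.card = W.deg v := by
    rw [Network.deg_eq_ncard, ← Set.ncard_coe_finset]
    simp [N]
  calc ∑ x ∈ L, W.graph.usedCount col v x
      = ∑ x ∈ L, (N.filter fun u => col u = some x).card := by
        refine Finset.sum_congr rfl fun x _ => ?_
        rw [SimpleGraph.usedCount, ← Set.ncard_coe_finset]
        simp [N, Finset.filter_filter]
    _ = ∑ u ∈ N, (L.filter fun x => col u = some x).card :=
        Finset.sum_card_bipartiteAbove_eq_sum_card_bipartiteBelow (fun x u => col u = some x)
    _ ≤ ∑ u ∈ N, 1 := Finset.sum_le_sum fun u _ => by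
        rw [Finset.card_le_one]
        intro a ha b hb
        exact Option.some.inj
          ((Finset.mem_filter.1 ha).2.symm.trans (Finset.mem_filter.1 hb).2)
    _ = W.deg v := by rw [Finset.sum_const, smul_eq_mul, mul_one, hN]

/-- After all phases, every node is colored: otherwise its initial weight would be at most the
weight used by the neighbors, which is at most the degree, plus the small weights left on the
levels, which add up to at most `S` times the degree. -/
theorem PhaseInvariant.ne_none {V : Type} [Fintype V] {W : Network p V}
    {I : ListInstance W S' C} {lab : V → ℕ} {K : ℕ} {col : V → Option ℕ}
    (h : PhaseInvariant I S lab (Nat.log 2 p.Δ + 1) K ((Nat.log 2 p.Δ + 1) * K) col)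
    (hθ : 1 ≤ p.θ) (hS : 1 ≤ S) (hS' : S' = 16 * (p.θ : ℝ) * S) (hlab : ∀ v, lab v < K)
    (hconf : ∀ v, (Nat.log 2 p.Δ + 1) * W.graph.conflicts lab v ≤ W.deg v) (v : V) :
    col v ≠ none := by
  intro hv
  subst hS'
  set ℓ := Nat.log 2 p.Δ + 1 with hℓ
  set a := W.graph.usedCount col v
  have hlevel : ∀ i ∈ Finset.range ℓ, (levelWeight p.θ (I.L v) (I.d v) i a : ℝ) ≤
      S * (W.graph.conflicts lab v : ℝ) := by
    intro i hi
    have hi := Finset.mem_range.1 hi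
    have hK : 0 < K := (Nat.zero_le _).trans_lt (hlab v)
    -- the index of the phase with level `i` and base color `lab v`
    have h1 := h.blocked v hv (lab v + K * (ℓ - 1 - i)) ?_ ?_
    · rw [Nat.add_mul_div_left _ _ hK, Nat.div_eq_of_lt (hlab v), zero_add,
        show ℓ - 1 - (ℓ - 1 - i) = i by omega] at h1
      exact h1
    · calc lab v + K * (ℓ - 1 - i) < K + K * (ℓ - 1 - i) := Nat.add_lt_add_right (hlab v) _
        _ = (ℓ - 1 - i + 1) * K := by ring
        _ ≤ ℓ * K := Nat.mul_le_mul_right _ (by omega)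
    · rw [Nat.add_mul_mod_self_left, Nat.mod_eq_of_lt (hlab v)]
  have hsum : ∑ i ∈ Finset.range ℓ, levelWeight p.θ (I.L v) (I.d v) i a =
      ∑ x ∈ I.L v, (2 ^ defectLevel p.θ (I.d v x) - a x) := by
    rw [← Finset.sum_fiberwise_of_maps_to (t := Finset.range ℓ)
      (g := fun x => defectLevel p.θ (I.d v x))
      (fun x hx => Finset.mem_range.2
        (defectLevel_lt ((h.defect_lt v hv x hx).trans_le (W.deg_le v))))]
    refine Finset.sum_congr rfl fun i _ => Finset.sum_congr rfl fun x hx => ?_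
    rw [(Finset.mem_filter.1 hx).2]
  have hleft : ((∑ x ∈ I.L v, (2 ^ defectLevel p.θ (I.d v x) - a x) : ℕ) : ℝ) ≤
      S * (W.deg v : ℝ) := by
    rw [← hsum, Nat.cast_sum]
    calc ∑ i ∈ Finset.range ℓ, (levelWeight p.θ (I.L v) (I.d v) i a : ℝ)
        ≤ ∑ i ∈ Finset.range ℓ, S * (W.graph.conflicts lab v : ℝ) := Finset.sum_le_sum hlevel
      _ = S * ((ℓ * W.graph.conflicts lab v : ℕ) : ℝ) := by
          rw [Finset.sum_const, Finset.card_range, nsmul_eq_mul]; push_cast; ring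
      _ ≤ S * (W.deg v : ℝ) :=
          mul_le_mul_of_nonneg_left (Nat.cast_le.2 (hconf v)) (by linarith)
  have htotal : ∑ x ∈ I.L v, (I.d v x + 1) ≤ 6 * p.θ *
      (W.deg v + ∑ x ∈ I.L v, (2 ^ defectLevel p.θ (I.d v x) - a x)) := by
    refine le_trans ?_ (Nat.mul_le_mul_left _
      (Nat.add_le_add_right (W.sum_usedCount_le col v (I.L v)) _))
    rw [← Finset.sum_add_distrib, Finset.mul_sum]
    refine Finset.sum_le_sum fun x _ => ?_
    refine (succ_le_six_mul_pow_defectLevel hθ _).trans (Nat.mul_le_mul_left _ ?_)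
    exact le_add_tsub
  have hslack := I.slack v
  have htotal' : ∑ x ∈ I.L v, ((I.d v x : ℝ) + 1) ≤ 6 * (p.θ : ℝ) *
      ((W.deg v : ℝ) +
        ((∑ x ∈ I.L v, (2 ^ defectLevel p.θ (I.d v x) - a x) : ℕ) : ℝ)) := by
    exact_mod_cast htotal
  have hθ0 : (0 : ℝ) ≤ p.θ := Nat.cast_nonneg _
  have hd0 : (0 : ℝ) ≤ W.deg v := Nat.cast_nonneg _
  have h1 : (W.deg v : ℝ) ≤ S * W.deg v := by nlinarith
  have h2 : 6 * (p.θ : ℝ) * ((W.deg v : ℝ) +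
      ((∑ x ∈ I.L v, (2 ^ defectLevel p.θ (I.d v x) - a x) : ℕ) : ℝ)) ≤
      6 * (p.θ : ℝ) * (S * W.deg v + S * W.deg v) :=
    mul_le_mul_of_nonneg_left (add_le_add h1 hleft) (by positivity)
  have h3 : 0 ≤ (p.θ : ℝ) * (S * W.deg v) := by positivity
  nlinarith

/-- A complete coloring that satisfies the invariant solves the defective coloring instance. -/
theorem PhaseInvariant.isDefectiveColoring {V : Type} [Fintype V] {W : Network p V}
    {I : ListInstance W S' C} {lab : V → ℕ} {ℓ K j : ℕ} {col : V → Option ℕ}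
    (h : PhaseInvariant I S lab ℓ K j col) (hθ : 1 ≤ p.θ) (hcol : ∀ v, col v ≠ none) :
    I.IsDefectiveColoring fun v => (col v).getD 0 := by
  obtain ⟨O, D, hO, hD⟩ := h.orientation
  have hsome : ∀ v, col v = some ((col v).getD 0) := by
    intro v
    obtain ⟨x, hx⟩ := Option.ne_none_iff_exists'.1 (hcol v)
    rw [hx, Option.getD_some]
  have hiff : ∀ u v, (col u).getD 0 = (col v).getD 0 ↔ col u = some ((col v).getD 0) := by
    intro u v
    conv_rhs => rw [hsome u]
    exact Option.some_inj.symm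
  intro v
  obtain ⟨h1, h2, -⟩ := hD v _ (hsome v)
  refine ⟨h1, ?_⟩
  rcases h2 with h2 | h2
  · refine le_trans ?_ h2
    rw [Network.deg_eq_ncard]
    exact Set.ncard_le_ncard (fun u hu => hu.1) (Set.toFinite _)
  · refine le_trans (W.graph.ncard_sameColor_le W.nbhdIndependence_le hθ _ D O ?_ ?_ ?_ v) h2
    · exact fun u v huv he => hO u v _ huv ((hsome u).trans (congrArg some he)) (hsome v)
    · intro v
      simp only [hiff]
      exact (hD v _ (hsome v)).2.2.2.1
    · intro v u huv he
      exact (hD v _ (hsome v)).2.2.2.2 u huv ((hiff u v).1 he)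

theorem exists_initial_phaseInvariant (p : NetworkParams) (S S' : ℝ) (C : ℕ) (hΔ : 1 ≤ p.Δ)
    (lab : ∀ X : BundledInstance p S' C, X.V → ℕ) (K : ℕ) :
    ∃ col : ∀ X : BundledInstance p S' C, X.V → Option ℕ, LocallyComputable 0 col ∧
      ∀ X, PhaseInvariant X.I S (lab X) (Nat.log 2 p.Δ + 1) K 0 (col X) := by
  classical
  let pick : NodeInput → Option ℕ := fun b =>
    if h : ∃ x ∈ b.list, b.degree ≤ b.defect x then some h.choose else none
  refine ⟨_, LocallyComputable.of_input pick, fun X => ⟨fun v hv x hx => ?_, fun v _ j' hj' =>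
    absurd hj' (Nat.not_lt_zero _), fun _ _ => True, fun _ => p.Δ, fun _ _ _ _ _ _ => Or.inl
      trivial, fun v x hv => ?_⟩⟩
  · by_contra hlt
    have hex : ∃ x ∈ (X.I.input v).list, (X.I.input v).degree ≤ (X.I.input v).defect x :=
      ⟨x, hx, not_lt.1 hlt⟩
    simp only [pick, dif_pos hex] at hv
    exact absurd hv (by simp)
  · by_cases hex : ∃ x ∈ (X.I.input v).list, (X.I.input v).degree ≤ (X.I.input v).defect x
    · simp only [pick, dif_pos hex, Option.some.injEq] at hv
      obtain ⟨h1, h2⟩ := hex.choose_spec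
      rw [hv] at h1 h2
      refine ⟨h1, Or.inl h2, ?_, ?_, fun _ _ _ _ => le_rfl⟩
      · rw [Nat.zero_div, Nat.sub_zero, Nat.add_sub_cancel]
        exact (Nat.pow_log_le_self 2 (by omega)).trans (Nat.le_succ _)
      · refine le_trans ?_ (X.W.deg_le v)
        rw [Network.deg_eq_ncard]
        exact Set.ncard_le_ncard (fun u hu => hu.1) (Set.toFinite _)
    · simp only [pick, dif_neg hex] at hv
      exact absurd hv (by simp)

/-- The reduction of list defective coloring to list arbdefective coloring. -/
theorem TD_le_of_solvesArbdefective {A : LocalAlgorithm NodeInput ArbOutput} {T : ℕ}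
    (hA : SolvesArbdefective p S C T A) (hΔ : 1 ≤ p.Δ) (hθ : 1 ≤ p.θ) (hq : 1 ≤ p.q)
    (hS : 1 ≤ S) (hC : 0 < C) :
    TD p (16 * (p.θ : ℝ) * S) C ≤ ((logStar p.q + 2 +
      (Nat.log 2 p.Δ + 1) * (1024 * (Nat.log 2 p.Δ + 1) ^ 2) * (2 + T) : ℕ) : ℕ∞) := by
  obtain ⟨lab, hlab, hlt, hconf⟩ :=
    exists_defective_base_coloring p (16 * (p.θ : ℝ) * S) C hΔ hq
  set ℓ := Nat.log 2 p.Δ + 1 with hℓ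
  set K := 1024 * ℓ ^ 2
  have hphases : ∀ j, ∃ col : ∀ X : BundledInstance p (16 * (p.θ : ℝ) * S) C, X.V → Option ℕ,
      LocallyComputable (logStar p.q + 2 + j * (2 + T)) col ∧
      ∀ X, PhaseInvariant X.I S (lab X) ℓ K j (col X) := by
    intro j
    induction j with
    | zero =>
      obtain ⟨col, hcol, hinv⟩ := exists_initial_phaseInvariant p S _ C hΔ lab K
      exact ⟨col, hcol.mono (Nat.zero_le _), hinv⟩
    | succ j ih =>
      obtain ⟨col, hcol, hinv⟩ := ih
      obtain ⟨col', hcol', hstep⟩ := exists_phaseStep hA (by linarith) hC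
        (hlab.mono (Nat.le_add_right _ _)) hcol (ℓ - 1 - j / K) (j % K)
      exact ⟨col', hcol'.mono (by rw [Nat.succ_mul]; omega), fun X => (hinv X).succ (hstep X)⟩
  obtain ⟨col, hcol, hinv⟩ := hphases (ℓ * K)
  refine TD_le_of_locallyComputable (hcol.map fun c => c.getD 0) fun X => ?_
  exact (hinv X).isDefectiveColoring hθ ((hinv X).ne_none hθ hS rfl (hlt X) (hconf X))

/-! ### Trivial parameters -/

theorem TD_le_zero (h : ∀ (X : BundledInstance p S C) (v : X.V),
    ∃ x ∈ X.I.L v, X.W.deg v ≤ X.I.d v x) : TD p S C ≤ (0 : ℕ) := by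
  classical
  let pick : NodeInput → ℕ := fun b =>
    if h : ∃ x ∈ b.list, b.degree ≤ b.defect x then h.choose else 0
  refine TD_le_of_locallyComputable (LocallyComputable.of_input pick) fun X v => ?_
  have hex : ∃ x ∈ (X.I.input v).list, (X.I.input v).degree ≤ (X.I.input v).defect x := h X v
  simp only [pick, dif_pos hex]
  refine ⟨hex.choose_spec.1, le_trans ?_ hex.choose_spec.2⟩
  refine le_of_le_of_eq ?_ (X.W.deg_eq_ncard v).symm
  exact Set.ncard_le_ncard (fun u hu => hu.1) (Set.toFinite _)

theorem ListInstance.list_nonempty {V : Type} [Fintype V] {W : Network p V}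
    (I : ListInstance W S C) (hS : 0 ≤ S) (v : V) : (I.L v).Nonempty := by
  by_contra h
  have h1 := I.slack v
  rw [Finset.not_nonempty_iff_eq_empty.1 h, Finset.sum_empty] at h1
  have : 0 ≤ S * (W.deg v : ℝ) := by positivity
  linarith

theorem TD_le_zero_of_deg_eq_zero (hS : 0 ≤ S)
    (h : ∀ (X : BundledInstance p S C) (v : X.V), X.W.deg v = 0) : TD p S C ≤ (0 : ℕ) :=
  TD_le_zero fun X v => by
    obtain ⟨x, hx⟩ := X.I.list_nonempty hS v
    exact ⟨x, hx, by rw [h]; exact Nat.zero_le _⟩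

theorem TD_le_zero_of_colors_le (hC : (C : ℝ) ≤ S) : TD p S C ≤ (0 : ℕ) := by
  refine TD_le_zero fun X v => ?_
  by_contra! hlt
  have h1 := X.I.slack v
  have h2 : ∑ x ∈ X.I.L v, ((X.I.d v x : ℝ) + 1) ≤ ∑ x ∈ X.I.L v, (X.W.deg v : ℝ) :=
    Finset.sum_le_sum fun x hx => by exact_mod_cast hlt x hx
  have h3 : ((X.I.L v).card : ℝ) ≤ C := by
    have := Finset.card_le_card (X.I.list_subset v)
    rw [Finset.card_range] at this
    exact_mod_cast this
  rw [Finset.sum_const, nsmul_eq_mul] at h2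
  have h4 : ((X.I.L v).card : ℝ) * (X.W.deg v : ℝ) ≤ S * X.W.deg v :=
    mul_le_mul_of_nonneg_right (h3.trans hC) (Nat.cast_nonneg _)
  linarith

/-- What the existence of an edge in some network says about the parameters. -/
theorem Network.params_of_adj {V : Type} [Fintype V] (W : Network p V) {v u : V}
    (h : W.graph.Adj v u) : 2 ≤ p.n ∧ 2 ≤ p.N ∧ 1 ≤ p.Δ ∧ 1 ≤ p.θ ∧ 2 ≤ p.q := by
  refine ⟨?_, ?_, ?_, ?_, ?_⟩
  · exact (Fintype.one_lt_card_iff.2 ⟨v, u, h.ne⟩).trans_le W.card_le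
  · have h1 := W.ident_lt v
    have h2 := W.ident_lt u
    have h3 : W.ident v ≠ W.ident u := fun e => h.ne (W.ident_injective e)
    omega
  · refine le_trans ?_ (W.deg_le v)
    rw [Network.deg_eq_ncard]
    exact (Set.ncard_pos (Set.toFinite _)).2 ⟨u, h⟩
  · refine le_trans ?_ W.nbhdIndependence_le
    rw [← Finset.card_singleton u]
    refine W.graph.card_le_nbhdIndependence v {u} (fun w hw => ?_) (fun w hw w' hw' => ?_)
    · rwa [Finset.mem_singleton.1 hw]
    · rw [Finset.mem_singleton.1 hw, Finset.mem_singleton.1 hw']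
      exact W.graph.irrefl
  · have h1 := (W.initColor v).2
    have h2 := (W.initColor u).2
    have h3 : (W.initColor v : ℕ) ≠ W.initColor u := fun e =>
      W.initColor.valid h (Fin.ext e)
    omega

/-! ### Maximum degree one -/

/-- If the maximum degree is at most one, one round suffices. On every edge, the endpoint with
priority keeps its first choice, which the other endpoint avoids. Priority is given to endpoints
that tolerate the conflict and otherwise to the smaller identifier. -/
theorem TD_le_one (hΔ : p.Δ ≤ 1) (hS : 1 ≤ S) : TD p S C ≤ (1 : ℕ) := by
  classical
  let special : NodeInput → Prop := fun b => ∃ x ∈ b.list, b.degree ≤ b.defect x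
  let first : NodeInput → ℕ := fun b => if h : special b then h.choose else
    if h : b.list.Nonempty then h.choose else 0
  let before : NodeInput → NodeInput → Prop := fun c b => special c ∨ c.ident < b.ident
  let out : NodeInput → ((NodeInput → Prop) → ℕ) → ℕ := fun b cnt =>
    if special b ∨ cnt (fun c => before c b) = 0 then first b else
      if h : ∃ x ∈ b.list, cnt (fun c => before c b ∧ first c = x) = 0 then h.choose else 0
  let cnt : ∀ X : BundledInstance p S C, X.V → (NodeInput → Prop) → ℕ := fun X v P =>
    {u | X.W.graph.Adj v u ∧ P (X.I.input u)}.ncard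
  have hcnt : LocallyComputable 1 (fun X v => out (X.I.input v) (cnt X v)) :=
    ((LocallyComputable.input 1).prod (LocallyComputable.input 0).neighborCount).map
      (fun b => out b.1 b.2)
  refine TD_le_of_locallyComputable hcnt fun X v => ?_
  have hcnt0 : ∀ v P, cnt X v P = 0 ↔ ∀ u, X.W.graph.Adj v u → ¬ P (X.I.input u) := by
    intro v P
    simp only [cnt]
    rw [Set.ncard_eq_zero (Set.toFinite _), Set.eq_empty_iff_forall_notMem]
    exact ⟨fun h u h1 h2 => h u ⟨h1, h2⟩, fun h u hu => h u hu.1 hu.2⟩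
  have hbefore : ∀ v, cnt X v (fun c => before c (X.I.input v)) = 0 ↔
      ∀ u, X.W.graph.Adj v u → ¬ before (X.I.input u) (X.I.input v) :=
    fun v => hcnt0 v fun c => before c (X.I.input v)
  have hfree : ∀ v x, cnt X v (fun c => before c (X.I.input v) ∧ first c = x) = 0 ↔
      ∀ u, X.W.graph.Adj v u →
        ¬ (before (X.I.input u) (X.I.input v) ∧ first (X.I.input u) = x) :=
    fun v x => hcnt0 v fun c => before c (X.I.input v) ∧ first c = x
  have hdeg : ∀ v, X.W.deg v ≤ 1 := fun v => (X.W.deg_le v).trans hΔ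
  have huniq : ∀ v u w, X.W.graph.Adj v u → X.W.graph.Adj v w → u = w := by
    intro v u w hu hw
    have h1 := hdeg v
    rw [Network.deg_eq_ncard] at h1
    exact (Set.ncard_le_one_iff (Set.toFinite _)).1 h1 hu hw
  have hfirst : ∀ v, first (X.I.input v) ∈ X.I.L v := by
    intro v
    by_cases h : special (X.I.input v)
    · simp only [first, dif_pos h]
      exact h.choose_spec.1
    · have h' : (X.I.input v).list.Nonempty := X.I.list_nonempty (by linarith) v
      simp only [first, dif_neg h, dif_pos h']
      exact h'.choose_spec
  -- a node without special color has defects zero and thus at least two colors to choose from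
  have hother : ∀ v, ¬ special (X.I.input v) → ∃ x ∈ (X.I.input v).list,
      cnt X v (fun c => before c (X.I.input v) ∧ first c = x) = 0 := by
    intro v hv
    have hd : ∀ x ∈ X.I.L v, X.I.d v x < X.W.deg v := fun x hx => by
      by_contra h
      exact hv ⟨x, hx, not_lt.1 h⟩
    have hslack := X.I.slack v
    obtain ⟨x₀, hx₀⟩ := X.I.list_nonempty (by linarith) v
    have hdeg1 : X.W.deg v = 1 := by
      have := hd x₀ hx₀
      have := hdeg v
      omega
    have hcard : 1 < (X.I.L v).card := by
      have h1 : ∑ x ∈ X.I.L v, ((X.I.d v x : ℝ) + 1) = (X.I.L v).card := by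
        rw [Finset.sum_congr rfl (g := fun _ => (1 : ℝ)) fun x hx => ?_]
        · simp
        · have : X.I.d v x = 0 := by have := hd x hx; omega
          simp [this]
      rw [h1, hdeg1, Nat.cast_one, mul_one] at hslack
      exact_mod_cast hS.trans_lt hslack
    obtain ⟨a, ha, b, hb, hab⟩ := Finset.one_lt_card.1 hcard
    by_cases hex : ∃ u, X.W.graph.Adj v u ∧ first (X.I.input u) = a
    · obtain ⟨u, hu, hua⟩ := hex
      refine ⟨b, hb, (hfree _ _).2 fun w hw h => hab ?_⟩
      rw [← hua, huniq v u w hu hw, h.2]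
    · exact ⟨a, ha, (hfree _ _).2 fun w hw h => hex ⟨w, hw, h.2⟩⟩
  have hkeep : ∀ v, (special (X.I.input v) ∨ cnt X v (fun c => before c (X.I.input v)) = 0) →
      out (X.I.input v) (cnt X v) = first (X.I.input v) := fun v h => if_pos h
  have havoid : ∀ v, ¬ (special (X.I.input v) ∨
      cnt X v (fun c => before c (X.I.input v)) = 0) →
      out (X.I.input v) (cnt X v) ∈ X.I.L v ∧ ∀ u, X.W.graph.Adj v u →
        before (X.I.input u) (X.I.input v) →
        first (X.I.input u) ≠ out (X.I.input v) (cnt X v) := by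
    intro v h
    have hex := hother v (fun hs => h (Or.inl hs))
    simp only [out, if_neg h, dif_pos hex]
    exact ⟨hex.choose_spec.1, fun u hu hb he =>
      (hfree _ _).1 hex.choose_spec.2 u hu ⟨hb, he⟩⟩
  have hconflict : ∀ v, ¬ special (X.I.input v) → ∀ u, X.W.graph.Adj v u →
      out (X.I.input u) (cnt X u) ≠ out (X.I.input v) (cnt X v) := by
    intro v hv u hvu he
    by_cases h0 : cnt X v (fun c => before c (X.I.input v)) = 0
    · have hu := (hbefore _).1 h0 u hvu
      have hne : X.W.ident u ≠ X.W.ident v := fun e => hvu.ne (X.W.ident_injective e).symm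
      have hlt : ¬ X.W.ident u < X.W.ident v := fun h => hu (Or.inr h)
      have hb : before (X.I.input v) (X.I.input u) :=
        Or.inr (show X.W.ident v < X.W.ident u by omega)
      have hu' : ¬ (special (X.I.input u) ∨ cnt X u (fun c => before c (X.I.input u)) = 0) := by
        rintro (h | h)
        · exact hu (Or.inl h)
        · exact (hbefore _).1 h v hvu.symm hb
      exact (havoid u hu').2 v hvu.symm hb ((hkeep v (Or.inr h0)).symm.trans he.symm)
    · have hb : before (X.I.input u) (X.I.input v) := by
        by_contra hb
        exact h0 ((hbefore _).2 fun w hw => huniq v u w hvu hw ▸ hb)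
      have hu : special (X.I.input u) ∨ cnt X u (fun c => before c (X.I.input u)) = 0 := by
        refine hb.imp id fun hlt => (hbefore _).2 fun w hw => ?_
        rw [← huniq u v w hvu.symm hw]
        rintro (h | h)
        · exact hv h
        · exact lt_asymm h hlt
      exact (havoid v (fun h => h.elim hv h0)).2 u hvu hb ((hkeep u hu).symm.trans he)
  have hmem : out (X.I.input v) (cnt X v) ∈ X.I.L v := by
    by_cases h : special (X.I.input v) ∨ cnt X v (fun c => before c (X.I.input v)) = 0
    · rw [hkeep v h]
      exact hfirst v
    · exact (havoid v h).1
  refine ⟨hmem, ?_⟩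
  by_cases hv : special (X.I.input v)
  · rw [hkeep v (Or.inl hv)]
    simp only [first, dif_pos hv]
    refine le_trans ?_ hv.choose_spec.2
    refine le_of_le_of_eq ?_ (X.W.deg_eq_ncard v).symm
    exact Set.ncard_le_ncard (fun u hu => hu.1) (Set.toFinite _)
  · refine le_of_eq_of_le ?_ (Nat.zero_le _)
    rw [Set.ncard_eq_zero (Set.toFinite _), Set.eq_empty_iff_forall_notMem]
    exact fun u hu => hconflict v hv u hu.1 hu.2

/-! ### Arbdefective coloring needs communication -/

theorem Bool.toNat_injective : Function.Injective Bool.toNat := by decide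

/-- The network that consists of a single edge. -/
def Network.edge (p : NetworkParams) (hn : 2 ≤ p.n) (hN : 2 ≤ p.N) (hΔ : 1 ≤ p.Δ) (hθ : 1 ≤ p.θ)
    (hq : 2 ≤ p.q) : Network p Bool where
  graph := ⊤
  card_le := by simpa using hn
  maxDegree_le := by
    refine le_trans (Nat.le_of_lt_succ ?_) hΔ
    convert SimpleGraph.maxDegree_lt_card_verts (⊤ : SimpleGraph Bool)
    exact Fintype.card_bool.symm
  nbhdIndependence_le := by
    refine Finset.sup_le fun v _ => le_trans ?_ hθ
    obtain ⟨t, ht⟩ := ((⊤ : SimpleGraph Bool).induce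
      ((⊤ : SimpleGraph Bool).neighborSet v)).exists_isNIndepSet_indepNum
    rw [← ht.card_eq, Finset.card_le_one]
    intro a ha b hb
    by_contra hab
    exact ht.isIndepSet ha hb hab (fun e => hab (Subtype.ext e))
  ident := Bool.toNat
  ident_injective := Bool.toNat_injective
  ident_lt v := (Bool.toNat_lt v).trans_le hN
  initColor := SimpleGraph.Coloring.mk (fun v => ⟨v.toNat, (Bool.toNat_lt v).trans_le hq⟩)
    fun h e => h.ne (Bool.toNat_injective (Fin.mk.inj e))

/-- Without communication, the two endpoints of an edge choose their colors independently of the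
list of the other endpoint. If `C` is large compared to `S`, the colors that one endpoint takes
for varying lists cover all but few colors, and hence the whole list of the other endpoint, for
some such list. -/
theorem not_solvesArbdefective_zero (hn : 2 ≤ p.n) (hN : 2 ≤ p.N) (hΔ : 1 ≤ p.Δ) (hθ : 1 ≤ p.θ)
    (hq : 2 ≤ p.q) (hS : 1 ≤ S) (hC : 16 * S < C) (A : LocalAlgorithm NodeInput ArbOutput) :
    ¬ SolvesArbdefective p S C 0 A := by
  classical
  intro hA
  let W := Network.edge p hn hN hΔ hθ hq
  have hdeg : ∀ v, W.deg v = 1 := by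
    intro v
    rw [Network.deg_eq_ncard, Set.ncard_eq_one]
    exact ⟨!v, by ext u; cases u <;> cases v <;> simp [W, Network.edge]⟩
  set k := ⌊S⌋₊ + 1 with hk
  have hkC : 2 * k ≤ C := by
    have h1 : (k : ℝ) ≤ S + 1 := by
      rw [hk]; push_cast; linarith [Nat.floor_le (show 0 ≤ S by linarith)]
    have h2 : ((2 * k : ℕ) : ℝ) ≤ C := by push_cast; linarith
    exact_mod_cast h2
  let f : Bool → Finset ℕ → ℕ := fun v L =>
    (A.output (A.init ⟨v.toNat, v.toNat, 1, L, fun _ => 0⟩)).color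
  have key : ∀ L : Bool → Finset ℕ, (∀ v, L v ⊆ Finset.range C) → (∀ v, (L v).card = k) →
      (∀ v, f v (L v) ∈ L v) ∧ f false (L false) ≠ f true (L true) := by
    intro L hL hcard
    let I : ListInstance W S C :=
      { L := L
        d := fun _ _ => 0
        list_subset := hL
        slack := fun v => by
          rw [hdeg]
          simp only [Nat.cast_zero, zero_add, Finset.sum_const, hcard v, hk, nsmul_eq_mul,
            Nat.cast_one, mul_one]
          push_cast
          exact Nat.lt_floor_add_one S }
    obtain ⟨h1, h2, h3⟩ := hA Bool W I
    have hrun : ∀ v, (A.run W.graph W.ident I.input 0 v).color = f v (L v) := by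
      intro v
      have : I.input v = ⟨v.toNat, v.toNat, 1, L v, fun _ => 0⟩ := by
        rw [ListInstance.input, hdeg]
        rfl
      simp only [LocalAlgorithm.run, LocalAlgorithm.stateAfter, this, f]
    simp only [hrun] at h1 h2 h3
    refine ⟨h1, fun he => ?_⟩
    have hne : ∀ v u, W.graph.Adj v u → f u (L u) = f v (L v) →
        W.ident u ∉ (A.run W.graph W.ident I.input 0 v).out := by
      intro v u hvu he' hmem
      have h4 := Nat.le_zero.1 (h3 v)
      rw [Set.ncard_eq_zero (Set.toFinite _)] at h4
      exact Set.eq_empty_iff_forall_notMem.1 h4 u ⟨hvu, he', hmem⟩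
    have hadj : W.graph.Adj false true := show false ≠ true by decide
    rcases h2 false true hadj he with h | h
    · exact hne false true hadj he.symm h.1
    · exact hne true false hadj.symm he h.1
  have hf : ∀ v L, L ⊆ Finset.range C → L.card = k → f v L ∈ L := fun v L hL hc =>
    (key (fun _ => L) (fun _ => hL) (fun _ => hc)).1 v
  -- the colors that the first node takes for suitable lists
  let B := (Finset.range C).filter fun x =>
    ∃ L ⊆ Finset.range C, L.card = k ∧ f false L = x
  have hB : k ≤ B.card := by
    by_contra hlt
    have h1 := Finset.card_sdiff_add_card_eq_card (show B ⊆ Finset.range C from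
      Finset.filter_subset _ _)
    rw [Finset.card_range] at h1
    obtain ⟨L, hL, hc⟩ := Finset.exists_subset_card_eq
      (show k ≤ (Finset.range C \ B).card by omega)
    have hLC := hL.trans Finset.sdiff_subset
    have h2 := hf false L hLC hc
    exact (Finset.mem_sdiff.1 (hL h2)).2 (Finset.mem_filter.2 ⟨hLC h2, L, hLC, hc, rfl⟩)
  obtain ⟨L₁, hL₁, hc₁⟩ := Finset.exists_subset_card_eq hB
  have hL₁C := hL₁.trans (Finset.filter_subset _ _)
  obtain ⟨-, L₀, hL₀C, hc₀, he⟩ := Finset.mem_filter.1 (hL₁ (hf true L₁ hL₁C hc₁))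
  exact (key (fun v => if v then L₁ else L₀) (by simp [hL₁C, hL₀C]) (by simp [hc₁, hc₀])).2
    (by simpa using he)

/-! ### The complexity bound -/

theorem one_le_logStar {q : ℕ} (hq : 2 ≤ q) : 1 ≤ logStar q := by
  by_contra h
  have h1 := iterate_logb_logStar_le q
  rw [show logStar q = 0 by omega, Function.iterate_zero, id] at h1
  have : q ≤ 1 := by exact_mod_cast h1
  omega

/-- The number of rounds of the reduction in terms of `log Δ`. -/
theorem reduction_rounds_le {Δ T s : ℕ} (hΔ : 2 ≤ Δ) (hT : 1 ≤ T) :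
    ((s + 2 + (Nat.log 2 Δ + 1) * (1024 * (Nat.log 2 Δ + 1) ^ 2) * (2 + T) : ℕ) : ℝ) ≤
      30000 * Real.logb 2 (Δ : ℝ) ^ 3 * T + 30000 * s := by
  have hΔ' : (2 : ℝ) ≤ Δ := by exact_mod_cast hΔ
  have hT' : (1 : ℝ) ≤ T := by exact_mod_cast hT
  have hL : 1 ≤ Real.logb 2 (Δ : ℝ) := by
    rw [Real.le_logb_iff_rpow_le (by norm_num) (by linarith)]
    simpa using hΔ'
  have hlog : (Nat.log 2 Δ : ℝ) ≤ Real.logb 2 (Δ : ℝ) := Real.natLog_le_logb Δ 2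
  set L := Real.logb 2 (Δ : ℝ)
  have hL3 : 1 ≤ L ^ 3 := one_le_pow₀ hL
  have hℓ : ((Nat.log 2 Δ : ℝ) + 1) ^ 3 ≤ 8 * L ^ 3 := by
    calc ((Nat.log 2 Δ : ℝ) + 1) ^ 3 ≤ (2 * L) ^ 3 :=
          pow_le_pow_left₀ (by positivity) (by linarith) 3
      _ = 8 * L ^ 3 := by ring
  have hLT : 1 ≤ L ^ 3 * T := one_le_mul_of_one_le_of_one_le hL3 hT'
  have hs : (0 : ℝ) ≤ s := Nat.cast_nonneg _
  calc ((s + 2 + (Nat.log 2 Δ + 1) * (1024 * (Nat.log 2 Δ + 1) ^ 2) * (2 + T) : ℕ) : ℝ)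
      = s + 2 + 1024 * (((Nat.log 2 Δ : ℝ) + 1) ^ 3 * (2 + T)) := by push_cast; ring
    _ ≤ s + 2 + 1024 * (8 * L ^ 3 * (3 * T)) := by
        gcongr
        linarith
    _ = s + 2 + 24576 * (L ^ 3 * T) := by ring
    _ ≤ 30000 * L ^ 3 * T + 30000 * s := by linarith

end

theorem mainTheorem3 :
    ∃ c : ℝ, 0 < c ∧ ∀ (p : NetworkParams) (S : ℝ) (C : ℕ), 1 ≤ S →
      (TD p (16 * (p.θ : ℝ) * S) C : ℝ≥0∞) ≤
        ENNReal.ofReal (c * Real.logb 2 (p.Δ : ℝ) ^ 3) * (TA p S C : ℝ≥0∞) +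
          ENNReal.ofReal (c * (logStar p.q : ℝ)) := by
  refine ⟨30000, by norm_num, fun p S C hS => ?_⟩
  have htriv : TD p (16 * (p.θ : ℝ) * S) C ≤ (0 : ℕ) →
      (TD p (16 * (p.θ : ℝ) * S) C : ℝ≥0∞) ≤
        ENNReal.ofReal (30000 * Real.logb 2 (p.Δ : ℝ) ^ 3) * (TA p S C : ℝ≥0∞) +
          ENNReal.ofReal (30000 * (logStar p.q : ℝ)) := by
    intro h
    have h' := ENat.toENNReal_le.2 h
    rw [ENat.toENNReal_coe, Nat.cast_zero] at h'
    exact h'.trans zero_le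
  by_cases hE : ∀ (X : BundledInstance p (16 * (p.θ : ℝ) * S) C) (v : X.V), X.W.deg v = 0
  · exact htriv (TD_le_zero_of_deg_eq_zero (by positivity) hE)
  push Not at hE
  obtain ⟨X, v, hv⟩ := hE
  rw [Network.deg_eq_ncard] at hv
  obtain ⟨u, hu⟩ := (Set.ncard_pos (Set.toFinite _)).1 (Nat.pos_of_ne_zero hv)
  obtain ⟨hn, hN, hΔ, hθ, hq⟩ := X.W.params_of_adj hu
  have hθ' : (1 : ℝ) ≤ p.θ := by exact_mod_cast hθ
  rcases le_or_gt (C : ℝ) (16 * (p.θ : ℝ) * S) with hC | hC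
  · exact htriv (TD_le_zero_of_colors_le hC)
  have hC16 : 16 * S < C := by nlinarith
  have hC0 : 0 < C := by
    have : (0 : ℝ) < C := by linarith
    exact_mod_cast this
  rcases Nat.lt_or_ge p.Δ 2 with hΔ2 | hΔ2
  · have h := ENat.toENNReal_le.2 (TD_le_one (p := p) (C := C) (S := 16 * (p.θ : ℝ) * S)
      (by omega) (by nlinarith))
    refine h.trans (le_trans ?_ le_add_self)
    rw [ENat.toENNReal_coe, Nat.cast_one, ENNReal.one_le_ofReal]
    have : (1 : ℝ) ≤ logStar p.q := by exact_mod_cast one_le_logStar hq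
    linarith
  by_cases hex : ∃ T A, SolvesArbdefective p S C T A
  · classical
    obtain ⟨A, hA⟩ := Nat.find_spec hex
    have hTA : (Nat.find hex : ℕ∞) ≤ TA p S C :=
      le_iInf₂ fun T hT => Nat.cast_le.2 (Nat.find_min' hex hT)
    have hT : 1 ≤ Nat.find hex := by
      by_contra h0
      rw [show Nat.find hex = 0 by omega] at hA
      exact not_solvesArbdefective_zero hn hN hΔ hθ hq hS hC16 A hA
    set T := Nat.find hex
    have h := ENat.toENNReal_le.2 (TD_le_of_solvesArbdefective hA hΔ hθ (by omega) hS hC0)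
    refine h.trans ?_
    have hTA' := ENat.toENNReal_le.2 hTA
    rw [ENat.toENNReal_coe] at hTA' ⊢
    refine le_trans ?_ (add_le_add_left (mul_le_mul_right hTA' _) _)
    have hlog : 0 ≤ Real.logb 2 (p.Δ : ℝ) :=
      Real.logb_nonneg (by norm_num) (by exact_mod_cast hΔ)
    rw [← ENNReal.ofReal_natCast, ← ENNReal.ofReal_natCast (n := T),
      ← ENNReal.ofReal_mul (by positivity), ← ENNReal.ofReal_add (by positivity) (by positivity)]
    exact ENNReal.ofReal_le_ofReal (reduction_rounds_le hΔ2 hT)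
  · have hTA : TA p S C = ⊤ := by
      simp only [TA, iInf_eq_top]
      exact fun T hT => absurd ⟨T, hT⟩ hex
    have hlog : 0 < Real.logb 2 (p.Δ : ℝ) :=
      Real.logb_pos (by norm_num) (by exact_mod_cast hΔ2)
    rw [hTA, ENat.toENNReal_top, ENNReal.mul_top
      (ENNReal.ofReal_pos.2 (by positivity)).ne', top_add]
    exact le_top
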